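/- Let $n\ge 2$ and let $G$ be a free metabelian group of rank $n$. Then $G$, as a structure in the language $\{\cdot,{}^{-1},1\}$ of groups, is absolutely and injectively interpretable in the ring $\mathbb Z$: for some $d$ there are formulas without parameters in the language of rings that define in $\mathbb Z$ a set $S\subseteq\mathbb Z^d$ and operations on $S$ such that the resulting structure, with equality of tuples as equality, is isomorphic to $G$. More precisely, write $[g,h]=g^{-1}h^{-1}gh$ and let $R=\mathbb Z[a_1^{\pm1},\dots,a_n^{\pm1}]$ be the ring of Laurent polynomials. For a basis $x=(x_1,\dots,x_n)$ of $G$ (a tuple that induces an isomorphism $F/F''\cong G$, where $F$ is the free group of rank $n$), $R$ acts on $G'=[G,G]$: the monomial $a_1^{\alpha_1}\cdots a_n^{\alpha_n}$ acts as $u\mapsto (x_1^{\alpha_1}\cdots x_n^{\alpha_n})^{-1}\,u\,(x_1^{\alpha_1}\cdots x_n^{\alpha_n})$, and $u\mapsto u^Q$ is the linear extension to $Q\in R$. Call an injective map $\nu:R\to\mathbb N$ a computable coding if $\nu(R)$ is a computable set and the operations on $\nu(R)$ induced by addition and multiplication of $R$ are computable. Then computable codings $\nu$ exist, and for every computable coding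 $\nu$ the following hold. Every $g\in G$ has, relative to every basis $x$, a unique normal form $$g=x_1^{\gamma_1}\cdots x_n^{\gamma_n}\prod_{1\le j<i\le n}[x_i,x_j]^{\beta_{ij}},\qquad \gamma_i\in\mathbb Z,\quad \beta_{ij}\in\mathbb Z[a_1^{\pm1},\dots,a_i^{\pm1}],$$ and hence a tuple of coordinates $t_x(g)=(\gamma_1,\dots,\gamma_n,\nu(\beta_{21}),\dots,\nu(\beta_{n,n-1}))\in\mathbb Z^{n+n(n-1)/2}$. The operations $(t_x(g),t_x(h))\mapsto t_x(gh)$ and $t_x(g)\mapsto t_x(g^{-1})$ are computable, by algorithms that do not depend on $x$. There is an injective parameter-free code $\Gamma$, not depending on $x$, such that for every basis $x$ the domain of $\Gamma$ in $\mathbb Z$ is $S_G=\{t_x(g): g\in G\}$ and $\Gamma$ interprets $G$ in $\mathbb Z$ with the coordinate map $S_G\to G$, $t_x(g)\mapsto g$; in particular $S_G$ and the graphs of multiplication and inversion in these coordinates are definable in $\mathbb Z$. -/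

import Mathlib

universe u v

/-! ### Absolute and injective interpretations -/

/-- A parameter-free interpretation code of `L`-structures in `L'`-structures. Elements are coded by
tuples indexed by `ι`; for a finite `ι` the dimension of the code is the number of elements
of `ι`. In `func f` the variables `Sum.inl (i, j)` form the `i`-th argument and the variables
`Sum.inr j` form the value. -/
structure InterpretationCode (L : FirstOrder.Language.{0, 0}) (L' : FirstOrder.Language.{0, 0}) (ι : Type) where
  /-- the formula defining the set of codes -/
  dom : L'.Formula ι
  /-- the formula defining the equivalence relation on the set of codes -/
  eqv : L'.Formula (ι ⊕ ι)
  /-- the formulas defining the graphs of the operations and the constants -/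
  func : ∀ {k : ℕ}, L.Functions k → L'.Formula ((Fin k × ι) ⊕ ι)
  /-- the formulas defining the predicates -/
  rel : ∀ {k : ℕ}, L.Relations k → L'.Formula (Fin k × ι)

namespace InterpretationCode

variable {L L' : FirstOrder.Language.{0, 0}} {ι : Type}

/-- The subset of `B ^ ι` defined by the domain formula. -/
def Dom (Γ : InterpretationCode L L' ι) (B : Type v) [L'.Structure B] : Set (ι → B) :=
  {s | Γ.dom.Realize s}

/-- `μ` is a coordinate map of the interpretation of `A` in `B` by the code `Γ`: a surjection
from the domain of `Γ` in `B` onto `A` whose fibres are the classes of the relation defined by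
`eqv`, and under which the formulas of `Γ` define the operations and predicates of `A`.
Equivalently, `μ` induces an isomorphism onto `A` from the quotient structure defined by `Γ`. -/
structure IsCoordinateMap (Γ : InterpretationCode L L' ι) {A : Type u} {B : Type v}
    [L.Structure A] [L'.Structure B] (μ : Γ.Dom B → A) : Prop where
  surjective : Function.Surjective μ
  eqv_iff : ∀ s t : Γ.Dom B,
    Γ.eqv.Realize (Sum.elim (s : ι → B) (t : ι → B)) ↔ μ s = μ t
  func_iff : ∀ {k : ℕ} (f : L.Functions k) (s : Fin k → Γ.Dom B) (t : Γ.Dom B),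
    (Γ.func f).Realize (Sum.elim (fun p : Fin k × ι => (s p.1 : ι → B) p.2) (t : ι → B)) ↔
      FirstOrder.Language.Structure.funMap f (fun i => μ (s i)) = μ t
  rel_iff : ∀ {k : ℕ} (r : L.Relations k) (s : Fin k → Γ.Dom B),
    (Γ.rel r).Realize (fun p : Fin k × ι => (s p.1 : ι → B) p.2) ↔
      FirstOrder.Language.Structure.RelMap r (fun i => μ (s i))

/-- The code is injective in `B`: its equivalence formula defines the identity relation. -/
def IsInjective (Γ : InterpretationCode L L' ι) (B : Type v) [L'.Structure B] : Prop :=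
  ∀ s t : ι → B, Γ.eqv.Realize (Sum.elim s t) ↔ s = t

end InterpretationCode

/-- `A` is absolutely (without parameters) and injectively interpretable in `B`. -/
def AbsolutelyInjectivelyInterpretable (L L' : FirstOrder.Language.{0, 0}) (A : Type u) (B : Type v)
    [L.Structure A] [L'.Structure B] : Prop :=
  ∃ (d : ℕ) (Γ : InterpretationCode L L' (Fin d)), Γ.IsInjective B ∧
    ∃ μ : Γ.Dom B → A, Γ.IsCoordinateMap μ

/-! ### The language of groups, and the ring `ℤ` as a structure -/

/-- The function symbols of the language of groups. -/
inductive GroupFunc : ℕ → Type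
  | mul : GroupFunc 2
  | inv : GroupFunc 1
  | one : GroupFunc 0

/-- The language of groups: multiplication, inversion and the identity element. -/
def groupLanguage : FirstOrder.Language.{0, 0} := ⟨GroupFunc, fun _ => Empty⟩

/-- Every group is a structure in the language of groups. -/
instance groupLanguageStructure (G : Type u) [Group G] : groupLanguage.Structure G where
  funMap {_} f := match f with
    | GroupFunc.mul => fun a => a 0 * a 1
    | GroupFunc.inv => fun a => (a 0)⁻¹
    | GroupFunc.one => fun _ => 1
  RelMap r _ := Empty.elim r

/-- The ring of integers as a structure in the language of rings. -/
instance intRingStructure : FirstOrder.Ring.CompatibleRing ℤ :=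
  FirstOrder.Ring.compatibleRingOfRing ℤ

/-! ### Free metabelian groups and normal forms -/

/-- A group is metabelian if its commutator subgroup is abelian. -/
abbrev IsMetabelian (G : Type u) [Group G] : Prop := IsMulCommutative (commutator G)

/-- The tuple `x` is a basis of `G` as a free metabelian group: it induces an isomorphism of
`F / F''` onto `G`, where `F` is the free group of rank `n`. -/
def IsFreeMetabelianBasis {G : Type u} [Group G] {n : ℕ} (x : Fin n → G) : Prop :=
  Function.Surjective (FreeGroup.lift x) ∧
    (FreeGroup.lift x).ker = derivedSeries (FreeGroup (Fin n)) 2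

/-- `G` is a free metabelian group of rank `n`. -/
def IsFreeMetabelianOfRank (n : ℕ) (G : Type u) [Group G] : Prop :=
  ∃ x : Fin n → G, IsFreeMetabelianBasis x

/-- The ring `ℤ[a₁, a₁⁻¹, …, aₙ, aₙ⁻¹]` of Laurent polynomials, as the group ring of `ℤⁿ`. -/
abbrev Laurent (n : ℕ) : Type := AddMonoidAlgebra ℤ (Fin n → ℤ)

/-- The pairs `(i, j)` with `j < i`. -/
abbrev LowerPair (n : ℕ) : Type := {p : Fin n × Fin n // p.2 < p.1}

/-- The index set of the `n + n (n - 1) / 2` coordinates. -/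
abbrev CoordIdx (n : ℕ) : Type := Fin n ⊕ LowerPair n

section NormalForm

open scoped IsMulCommutative

variable {G : Type u} [Group G] {n : ℕ}

/-- The ordered product `x₁ ^ γ₁ ⋯ xₙ ^ γₙ`. -/
def orderedPower (x : Fin n → G) (γ : Fin n → ℤ) : G :=
  (List.ofFn fun i => x i ^ γ i).prod

/-- The commutator `g⁻¹ h⁻¹ g h`, as an element of the commutator subgroup. -/
def rightCommutator (g h : G) : commutator G :=
  ⟨g⁻¹ * h⁻¹ * g * h, by
    have h1 := Subgroup.commutator_mem_commutator (Subgroup.mem_top g⁻¹) (Subgroup.mem_top h⁻¹)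
    rwa [commutatorElement_def, inv_inv, inv_inv, ← commutator_def] at h1⟩

/-- The element `u ^ Q` for `u` in the commutator subgroup `G'` and a Laurent polynomial `Q`: the
monomial `a₁ ^ α₁ ⋯ aₙ ^ αₙ` acts on `G'` as the conjugation
`u ↦ (x₁ ^ α₁ ⋯ xₙ ^ αₙ)⁻¹ u (x₁ ^ α₁ ⋯ xₙ ^ αₙ)`, and this action is extended linearly. -/
noncomputable def laurentPower [IsMetabelian G] (x : Fin n → G) (u : commutator G)
    (Q : Laurent n) : commutator G :=
  Q.coeff.prod fun α m => (MulAut.conjNormal (orderedPower x α)⁻¹ u) ^ m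

/-- The element `x₁ ^ γ₁ ⋯ xₙ ^ γₙ ∏_{j < i} [xᵢ, xⱼ] ^ βᵢⱼ`. -/
noncomputable def normalForm [IsMetabelian G] (x : Fin n → G) (γ : Fin n → ℤ)
    (β : LowerPair n → Laurent n) : G :=
  orderedPower x γ *
    (∏ p : LowerPair n, laurentPower x (rightCommutator (x p.1.1) (x p.1.2)) (β p) : commutator G)

/-- The polynomial `βᵢⱼ` involves only the variables `a₁, …, aᵢ` and their inverses. -/
def IsRestricted (β : LowerPair n → Laurent n) : Prop :=
  ∀ (p : LowerPair n) (α : Fin n → ℤ), α ∈ (β p).coeff.support → ∀ k, p.1.1 < k → α k = 0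

/-- `s = (γ₁, …, γₙ, ν(β₂₁), …, ν(βₙ,ₙ₋₁))` is the tuple of coordinates of `g` in a normal form
relative to `x`, where Laurent polynomials are coded by means of `ν`. -/
def IsCoordinateTuple [IsMetabelian G] (ν : Laurent n → ℕ) (x : Fin n → G)
    (s : CoordIdx n → ℤ) (g : G) : Prop :=
  ∃ (γ : Fin n → ℤ) (β : LowerPair n → Laurent n), IsRestricted β ∧ g = normalForm x γ β ∧
    s = Sum.elim γ (fun p => (ν (β p) : ℤ))

end NormalForm

/-! ### Computability -/

/-- A computable coding of Laurent polynomials by natural numbers: `ν` is injective, its range is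
computable, and so are the operations on codes induced by the ring operations. -/
structure IsComputableCoding {n : ℕ} (ν : Laurent n → ℕ) : Prop where
  injective : Function.Injective ν
  range : ComputablePred fun k : ℕ => k ∈ Set.range ν
  add : ∃ f : ℕ → ℕ → ℕ, Computable₂ f ∧ ∀ P Q, f (ν P) (ν Q) = ν (P + Q)
  mul : ∃ f : ℕ → ℕ → ℕ, Computable₂ f ∧ ∀ P Q, f (ν P) (ν Q) = ν (P * Q)

/-- Tuples of integers as inputs of algorithms, through an enumeration of the finite index set
(all such enumerations give the same computable functions). -/
noncomputable instance coordTuplePrimcodable (n : ℕ) : Primcodable (CoordIdx n → ℤ) :=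
  Primcodable.ofEquiv (Fin (Fintype.card (CoordIdx n)) → ℤ)
    (Equiv.arrowCongr (Fintype.equivFin (CoordIdx n)) (Equiv.refl ℤ))

/-! Two facts combine: recursively enumerable relations are definable in ℤ, and the multiplication
table of normal forms is a finite system of equations between Laurent polynomials in which the basis
does not occur.

Normal forms. The Magnus map sends xᵢ to (eᵢ, eᵢ) in ℤⁿ ⋉ Rⁿ; it exists because the target is
metabelian. It sends [xᵢ, xⱼ] to the Koszul vector (aⱼ - 1) eᵢ - (aᵢ - 1) eⱼ, and Koszul vectors
satisfy no nontrivial relation with restricted coefficients (`eq_zero_of_sum_koszul_eq_zero`). So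
normal forms are unique, even after applying the map. Conversely, a Jacobi-type identity
(`commutator_jacobi`) trades a forbidden variable for commutators of larger index, so the restricted
combinations form a submodule, and this is all of G' (`exists_normalForm`). Together these make the
Magnus map injective (`magnusMap_injective`), and equality of products can be tested on Magnus
vectors (`normalFormMul_iff`).

Computability. Restricted polynomials are enumerated as sums of signed monomials, whose ν-codes are
computed from finitely many fixed codes by the coded ring operations. Hence the graph of
multiplication on coordinate tuples is recursively enumerable, and products and inverses are found
by unbounded search. Codings exist because a polynomial can be coded by the least index of a pair of
exponent lists representing it (`exists_isComputableCoding`).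

Definability. ℕ is definable in ℤ by four squares, computations are coded by Gödel's β function
(`ArithDef.of_nat_partrec`), and `IntDefinable.of_rePred` transfers this to integer tuples. -/

/-! ### Arithmetical definability -/

section Arithmetic

open FirstOrder FirstOrder.Language

/-- The predicate `P` on tuples of integers is definable without parameters in the ring `ℤ`. -/
def IntDefinable {α : Type} (P : (α → ℤ) → Prop) : Prop :=
  ∃ φ : Language.ring.Formula α, ∀ v : α → ℤ, φ.Realize v ↔ P v

namespace IntDefinable

variable {α β : Type}

theorem of_iff {P Q : (α → ℤ) → Prop} (h : IntDefinable P) (H : ∀ v, P v ↔ Q v) :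
    IntDefinable Q :=
  h.imp fun _ hφ v => (hφ v).trans (H v)

theorem and {P Q : (α → ℤ) → Prop} (hP : IntDefinable P) (hQ : IntDefinable Q) :
    IntDefinable fun v => P v ∧ Q v := by
  obtain ⟨φ, hφ⟩ := hP
  obtain ⟨ψ, hψ⟩ := hQ
  exact ⟨φ ⊓ ψ, fun v => by rw [Formula.realize_inf, hφ, hψ]⟩

theorem not {P : (α → ℤ) → Prop} (hP : IntDefinable P) : IntDefinable fun v => ¬ P v := by
  obtain ⟨φ, hφ⟩ := hP
  exact ⟨φ.not, fun v => by rw [Formula.realize_not, hφ]⟩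

theorem or {P Q : (α → ℤ) → Prop} (hP : IntDefinable P) (hQ : IntDefinable Q) :
    IntDefinable fun v => P v ∨ Q v :=
  (hP.not.and hQ.not).not.of_iff fun v => by tauto

theorem comp {P : (α → ℤ) → Prop} (hP : IntDefinable P) (σ : α → β) :
    IntDefinable fun v : β → ℤ => P fun i => v (σ i) := by
  obtain ⟨φ, hφ⟩ := hP
  exact ⟨φ.relabel σ, fun v => by rw [Formula.realize_relabel, hφ]; rfl⟩

theorem exists_tuple [Finite β] {P : (α → ℤ) → (β → ℤ) → Prop}
    (hP : IntDefinable fun w : α ⊕ β → ℤ => P (fun i => w (Sum.inl i)) (fun i => w (Sum.inr i))) :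
    IntDefinable fun v => ∃ w, P v w := by
  obtain ⟨φ, hφ⟩ := hP
  exact ⟨Formula.iExs β φ, fun v => by simp [Formula.realize_iExs, hφ]⟩

theorem forall_index [Finite β] {P : β → (α → ℤ) → Prop} (hP : ∀ i, IntDefinable (P i)) :
    IntDefinable fun v => ∀ i, P i v := by
  choose φ hφ using hP
  exact ⟨Formula.iInf φ, fun v => by simp [Formula.realize_iInf, hφ]⟩

/-- Integer polynomial functions of the variables. -/
def IsTerm (f : (α → ℤ) → ℤ) : Prop :=
  ∃ t : Language.ring.Term α, ∀ v : α → ℤ, t.realize v = f v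

theorem IsTerm.var (i : α) : IsTerm fun v : α → ℤ => v i := ⟨Term.var i, fun _ => rfl⟩

theorem IsTerm.add {f g : (α → ℤ) → ℤ} (hf : IsTerm f) (hg : IsTerm g) :
    IsTerm fun v => f v + g v := by
  obtain ⟨t, ht⟩ := hf
  obtain ⟨s, hs⟩ := hg
  exact ⟨t + s, fun v => by rw [FirstOrder.Ring.realize_add, ht, hs]⟩

theorem IsTerm.mul {f g : (α → ℤ) → ℤ} (hf : IsTerm f) (hg : IsTerm g) :
    IsTerm fun v => f v * g v := by
  obtain ⟨t, ht⟩ := hf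
  obtain ⟨s, hs⟩ := hg
  exact ⟨t * s, fun v => by rw [FirstOrder.Ring.realize_mul, ht, hs]⟩

theorem IsTerm.neg {f : (α → ℤ) → ℤ} (hf : IsTerm f) : IsTerm fun v => - f v := by
  obtain ⟨t, ht⟩ := hf
  exact ⟨-t, fun v => by rw [FirstOrder.Ring.realize_neg, ht]⟩

theorem IsTerm.natCast (m : ℕ) : IsTerm fun _ : α → ℤ => (m : ℤ) := by
  induction m with
  | zero => exact ⟨0, fun v => by rw [FirstOrder.Ring.realize_zero]; rfl⟩
  | succ m ih =>
    have h1 : IsTerm fun _ : α → ℤ => (1 : ℤ) :=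
      ⟨1, fun v => by rw [FirstOrder.Ring.realize_one]⟩
    simpa using ih.add h1

theorem IsTerm.intCast (m : ℤ) : IsTerm fun _ : α → ℤ => m := by
  obtain ⟨k, rfl | rfl⟩ := m.eq_nat_or_neg
  · exact IsTerm.natCast k
  · exact (IsTerm.natCast k).neg

theorem eq {f g : (α → ℤ) → ℤ} (hf : IsTerm f) (hg : IsTerm g) :
    IntDefinable fun v => f v = g v := by
  obtain ⟨t, ht⟩ := hf
  obtain ⟨s, hs⟩ := hg
  exact ⟨t.equal s, fun v => by rw [Formula.realize_equal, ht, hs]⟩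

/-- Lagrange's four-square theorem. -/
theorem nonneg (i : α) : IntDefinable fun v : α → ℤ => 0 ≤ v i := by
  have h := exists_tuple (α := α) (β := Fin 4) (P := fun v w =>
      w 0 * w 0 + w 1 * w 1 + w 2 * w 2 + w 3 * w 3 = v i) <| by
    refine eq (((IsTerm.add ?_ ?_).add ?_).add ?_) (.var (Sum.inl i))
    all_goals exact IsTerm.mul (.var (Sum.inr _)) (.var (Sum.inr _))
  refine h.of_iff fun v => ⟨?_, fun hv => ?_⟩
  · rintro ⟨w, hw⟩
    rw [← hw]
    have := mul_self_nonneg (w 0)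
    have := mul_self_nonneg (w 1)
    have := mul_self_nonneg (w 2)
    have := mul_self_nonneg (w 3)
    linarith
  · obtain ⟨m, hm⟩ := Int.eq_ofNat_of_zero_le hv
    obtain ⟨a, b, c, d, h⟩ := Nat.sum_four_squares m
    refine ⟨![a, b, c, d], ?_⟩
    rw [hm, ← h]
    simp [sq]

end IntDefinable

/-! ### Arithmetical predicates and functions on ℕ. -/

/-- The predicate `P` on tuples of natural numbers is arithmetical: it is definable in `ℤ`. -/
def ArithDef {α : Type} (P : (α → ℕ) → Prop) : Prop :=
  ∃ Q : (α → ℤ) → Prop, IntDefinable Q ∧ ∀ v : α → ℕ, Q (fun i => (v i : ℤ)) ↔ P v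

/-- The function `f` on tuples of natural numbers is arithmetical: it has an arithmetical graph. -/
def ArithFun {α : Type} (f : (α → ℕ) → ℕ) : Prop :=
  ArithDef fun w : Option α → ℕ => w none = f fun i => w (some i)

namespace ArithDef

variable {α β : Type}

theorem of_iff {P Q : (α → ℕ) → Prop} (h : ArithDef P) (H : ∀ v, P v ↔ Q v) : ArithDef Q :=
  h.imp fun _ hφ => ⟨hφ.1, fun v => (hφ.2 v).trans (H v)⟩

theorem and {P Q : (α → ℕ) → Prop} (hP : ArithDef P) (hQ : ArithDef Q) :
    ArithDef fun v => P v ∧ Q v := by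
  obtain ⟨φ, h, hφ⟩ := hP
  obtain ⟨ψ, h', hψ⟩ := hQ
  exact ⟨_, h.and h', fun v => by rw [hφ, hψ]⟩

theorem not {P : (α → ℕ) → Prop} (hP : ArithDef P) : ArithDef fun v => ¬ P v := by
  obtain ⟨φ, h, hφ⟩ := hP
  exact ⟨_, h.not, fun v => by rw [hφ]⟩

theorem or {P Q : (α → ℕ) → Prop} (hP : ArithDef P) (hQ : ArithDef Q) :
    ArithDef fun v => P v ∨ Q v :=
  (hP.not.and hQ.not).not.of_iff fun v => by tauto

theorem imp {P Q : (α → ℕ) → Prop} (hP : ArithDef P) (hQ : ArithDef Q) :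
    ArithDef fun v => P v → Q v :=
  (hP.and hQ.not).not.of_iff fun v => by tauto

theorem comp {P : (α → ℕ) → Prop} (hP : ArithDef P) (σ : α → β) :
    ArithDef fun v : β → ℕ => P fun i => v (σ i) := by
  obtain ⟨φ, h, hφ⟩ := hP
  exact ⟨_, h.comp σ, fun v => hφ _⟩

theorem forall_index [Finite β] {P : β → (α → ℕ) → Prop} (hP : ∀ i, ArithDef (P i)) :
    ArithDef fun v => ∀ i, P i v := by
  choose Q h hQ using hP
  exact ⟨_, IntDefinable.forall_index h, fun v => forall_congr' fun i => hQ i v⟩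

theorem exists_tuple [Finite β] {P : (α → ℕ) → (β → ℕ) → Prop}
    (hP : ArithDef fun w : α ⊕ β → ℕ => P (fun i => w (Sum.inl i)) (fun i => w (Sum.inr i))) :
    ArithDef fun v => ∃ w, P v w := by
  obtain ⟨Q, h, hQ⟩ := hP
  -- The witnesses are confined to ℕ because `Q` is controlled only on tuples of natural numbers.
  refine ⟨fun v => ∃ w : β → ℤ, (∀ i, 0 ≤ w i) ∧ Q (Sum.elim v w), ?_, fun v => ?_⟩
  · refine IntDefinable.exists_tuple (P := fun v w => (∀ i, 0 ≤ w i) ∧ Q (Sum.elim v w)) ?_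
    refine (IntDefinable.forall_index fun i => IntDefinable.nonneg (Sum.inr i)).and ?_
    refine h.of_iff fun v => iff_of_eq (congrArg Q (funext fun i => ?_))
    cases i <;> rfl
  · have key : ∀ k : β → ℕ, Q (Sum.elim (fun i => (v i : ℤ)) fun i => (k i : ℤ)) ↔ P v k :=
      fun k => by
        refine Iff.trans ?_ (hQ (Sum.elim v k))
        refine iff_of_eq (congrArg Q (funext fun i => ?_))
        cases i <;> rfl
    constructor
    · rintro ⟨w, h0, hw⟩
      choose k hk using fun i => Int.eq_ofNat_of_zero_le (h0 i)
      obtain rfl : w = fun i => (k i : ℤ) := funext hk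
      exact ⟨k, (key k).1 hw⟩
    · rintro ⟨k, hk⟩
      exact ⟨fun i => k i, by simp, (key k).2 hk⟩

theorem exists_nat {P : (α → ℕ) → ℕ → Prop}
    (hP : ArithDef fun w : Option α → ℕ => P (fun i => w (some i)) (w none)) :
    ArithDef fun v => ∃ k, P v k :=
  (exists_tuple (β := Unit) (P := fun v w => P v (w ()))
    (hP.comp fun i : Option α => i.elim (Sum.inr ()) Sum.inl)).of_iff fun _ =>
      ⟨fun ⟨w, hw⟩ => ⟨w (), hw⟩, fun ⟨k, hk⟩ => ⟨fun _ => k, hk⟩⟩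

theorem forall_nat {P : (α → ℕ) → ℕ → Prop}
    (hP : ArithDef fun w : Option α → ℕ => P (fun i => w (some i)) (w none)) :
    ArithDef fun v => ∀ k, P v k :=
  (exists_nat (P := fun v k => ¬ P v k) hP.not).not.of_iff fun _ => by simp

/-- Substitution of arithmetical functions into a predicate. -/
theorem subst_tuple [Finite β] {P : (β → ℕ) → Prop} (hP : ArithDef P)
    {f : β → (α → ℕ) → ℕ} (hf : ∀ i, ArithFun (f i)) : ArithDef fun v => P fun i => f i v := by
  -- Functions are known only through their graphs, so their values are named by quantified
  -- variables.
  have h := exists_tuple (P := fun v w => (∀ i, w i = f i v) ∧ P w) <|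
    (forall_index fun i => (hf i).comp fun j : Option α => j.elim (Sum.inr i) Sum.inl).and
      (hP.comp Sum.inr)
  refine h.of_iff fun v => ⟨?_, fun hv => ⟨_, fun _ => rfl, hv⟩⟩
  rintro ⟨w, hw, hP⟩
  obtain rfl : w = fun i => f i v := funext hw
  exact hP

theorem rel₂ {R : ℕ → ℕ → Prop} (hR : ArithDef fun w : Fin 2 → ℕ => R (w 0) (w 1))
    {f g : (α → ℕ) → ℕ} (hf : ArithFun f) (hg : ArithFun g) : ArithDef fun v => R (f v) (g v) :=
  hR.subst_tuple (f := ![f, g]) fun i => by fin_cases i <;> assumption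

end ArithDef

namespace ArithFun

variable {α β : Type}

theorem of_eq {f g : (α → ℕ) → ℕ} (hf : ArithFun f) (H : ∀ v, f v = g v) : ArithFun g :=
  ArithDef.of_iff hf fun v => by rw [H]

theorem of_graph {f : (α → ℕ) → ℕ} {R : (α → ℕ) → ℕ → Prop}
    (h : ArithDef fun w : Option α → ℕ => R (fun i => w (some i)) (w none))
    (H : ∀ v k, R v k ↔ k = f v) : ArithFun f :=
  h.of_iff fun _ => H _ _

theorem of_term {f : (α → ℕ) → ℕ} {g : (α → ℤ) → ℤ} (hg : IntDefinable.IsTerm g)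
    (H : ∀ v : α → ℕ, g (fun i => v i) = f v) : ArithFun f := by
  obtain ⟨t, ht⟩ := hg
  have h' : IntDefinable.IsTerm fun w : Option α → ℤ => g fun i => w (some i) :=
    ⟨t.relabel some, fun v => by rw [Term.realize_relabel, ht]; rfl⟩
  refine ⟨_, IntDefinable.eq (.var none) h', fun v => ?_⟩
  rw [H fun i => v (some i)]
  exact Int.ofNat_inj

theorem var (i : α) : ArithFun fun v : α → ℕ => v i := of_term (.var i) fun _ => rfl

theorem const (m : ℕ) : ArithFun fun _ : α → ℕ => m := of_term (.natCast m) fun _ => rfl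

theorem comp {f : (α → ℕ) → ℕ} (hf : ArithFun f) (σ : α → β) :
    ArithFun fun v : β → ℕ => f fun i => v (σ i) :=
  ArithDef.of_iff (ArithDef.comp hf (Option.map σ)) fun _ => Iff.rfl

theorem lift {f : (α → ℕ) → ℕ} (hf : ArithFun f) :
    ArithFun fun v : Option α → ℕ => f fun i => v (some i) := hf.comp some

/-- Substitution of arithmetical functions into an arithmetical function. -/
theorem subst_tuple [Finite β] {F : (β → ℕ) → ℕ} (hF : ArithFun F)
    {f : β → (α → ℕ) → ℕ} (hf : ∀ i, ArithFun (f i)) : ArithFun fun v => F fun i => f i v :=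
  (ArithDef.subst_tuple (β := Option β) hF
    (f := fun i w => i.elim (w none) fun j => f j fun a => w (some a)) fun i => by
      cases i
      · exact var none
      · exact (hf _).lift).of_iff fun _ => Iff.rfl

theorem app₂ {F : ℕ → ℕ → ℕ} (hF : ArithFun fun w : Fin 2 → ℕ => F (w 0) (w 1))
    {f g : (α → ℕ) → ℕ} (hf : ArithFun f) (hg : ArithFun g) : ArithFun fun v => F (f v) (g v) :=
  hF.subst_tuple (f := ![f, g]) fun i => by fin_cases i <;> assumption

theorem add {f g : (α → ℕ) → ℕ} (hf : ArithFun f) (hg : ArithFun g) :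
    ArithFun fun v => f v + g v :=
  app₂ (F := (· + ·)) (of_term (.add (.var 0) (.var 1)) fun _ => by simp) hf hg

theorem mul {f g : (α → ℕ) → ℕ} (hf : ArithFun f) (hg : ArithFun g) :
    ArithFun fun v => f v * g v :=
  app₂ (F := (· * ·)) (of_term (.mul (.var 0) (.var 1)) fun _ => by simp) hf hg

end ArithFun

namespace ArithDef

variable {α : Type}

theorem eq {f g : (α → ℕ) → ℕ} (hf : ArithFun f) (hg : ArithFun g) :
    ArithDef fun v => f v = g v :=
  rel₂ (R := (· = ·)) ⟨_, IntDefinable.eq (.var 0) (.var 1), fun v => by simp⟩ hf hg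

theorem le {f g : (α → ℕ) → ℕ} (hf : ArithFun f) (hg : ArithFun g) :
    ArithDef fun v => f v ≤ g v :=
  (exists_nat (P := fun v k => g v = f v + k) (eq hg.lift (hf.lift.add (.var none)))).of_iff
    fun _ => le_iff_exists_add.symm

theorem lt {f g : (α → ℕ) → ℕ} (hf : ArithFun f) (hg : ArithFun g) :
    ArithDef fun v => f v < g v :=
  (le (hf.add (.const 1)) hg).of_iff fun _ => Nat.succ_le_iff

end ArithDef

namespace ArithFun

variable {α : Type}

theorem natPair {f g : (α → ℕ) → ℕ} (hf : ArithFun f) (hg : ArithFun g) :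
    ArithFun fun v => Nat.pair (f v) (g v) := by
  refine of_graph (R := fun v k => (f v < g v ∧ k = g v * g v + f v) ∨
    (¬ f v < g v ∧ k = f v * f v + f v + g v)) (.or (.and ?_ ?_) (.and ?_ ?_)) fun v k => ?_
  · exact .lt hf.lift hg.lift
  · exact .eq (var none) ((hg.lift.mul hg.lift).add hf.lift)
  · exact .not (.lt hf.lift hg.lift)
  · exact .eq (var none) (((hf.lift.mul hf.lift).add hf.lift).add hg.lift)
  · unfold Nat.pair
    split_ifs with h <;> simp [h]

theorem unpair_fst {f : (α → ℕ) → ℕ} (hf : ArithFun f) : ArithFun fun v => (f v).unpair.1 := by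
  refine of_graph (R := fun v a => ∃ k, Nat.pair a k = f v)
    (.exists_nat (.eq (natPair (var (some none)) (var none)) hf.lift.lift))
    fun v a => ⟨?_, fun h => ⟨(f v).unpair.2, by rw [h, Nat.pair_unpair]⟩⟩
  rintro ⟨k, hk⟩
  rw [← hk, Nat.unpair_pair]

theorem unpair_snd {f : (α → ℕ) → ℕ} (hf : ArithFun f) : ArithFun fun v => (f v).unpair.2 := by
  refine of_graph (R := fun v a => ∃ k, Nat.pair k a = f v)
    (.exists_nat (.eq (natPair (var none) (var (some none))) hf.lift.lift))
    fun v a => ⟨?_, fun h => ⟨(f v).unpair.1, by rw [h, Nat.pair_unpair]⟩⟩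
  rintro ⟨k, hk⟩
  rw [← hk, Nat.unpair_pair]

theorem mod_succ {f g : (α → ℕ) → ℕ} (hf : ArithFun f) (hg : ArithFun g) :
    ArithFun fun v => f v % (g v + 1) := by
  refine of_graph (R := fun v r => r < g v + 1 ∧ ∃ k, f v = r + (g v + 1) * k)
    (.and (.lt (var none) (hg.lift.add (const 1))) (.exists_nat (.eq hf.lift.lift
      ((var (some none)).add ((hg.lift.lift.add (const 1)).mul (var none))))))
    fun v r => ⟨?_, fun h => ?_⟩
  · rintro ⟨h, k, hk⟩
    rw [hk, Nat.add_mul_mod_self_left, Nat.mod_eq_of_lt h]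
  · rw [h]
    exact ⟨Nat.mod_lt _ (Nat.succ_pos _), _, (Nat.mod_add_div _ _).symm⟩

theorem beta {f g : (α → ℕ) → ℕ} (hf : ArithFun f) (hg : ArithFun g) :
    ArithFun fun v => Nat.beta (f v) (g v) :=
  mod_succ hf.unpair_fst ((hg.add (const 1)).mul hf.unpair_snd)

end ArithFun

/-! ### Gödel's β function and partial recursive functions. -/

theorem Nat.exists_beta (F : ℕ → ℕ) (m : ℕ) : ∃ c, ∀ i ≤ m, Nat.beta c i = F i := by
  refine ⟨Nat.unbeta (List.ofFn fun i : Fin (m + 1) => F i), fun i hi => ?_⟩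
  have := Nat.beta_unbeta_coe (List.ofFn fun i : Fin (m + 1) => F i)
    ⟨i, by simpa using Nat.lt_succ_of_le hi⟩
  rw [Fin.getElem_fin, List.getElem_ofFn] at this
  exact this

/-- A run of a primitive recursion is a finite sequence of values. Packing it into one number `c` by
the β function replaces the recursion by a single numerical quantifier and a bounded check. -/
theorem Part.mem_natRec {f : Part ℕ} {g : ℕ → ℕ → Part ℕ} {m y : ℕ} :
    (y ∈ (Nat.rec f (fun i IH => IH.bind (g i)) m : Part ℕ)) ↔
      ∃ c, (Nat.beta c 0 ∈ f ∧ ∀ i, i < m → Nat.beta c (i + 1) ∈ g i (Nat.beta c i)) ∧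
        y = Nat.beta c m := by
  have key : (y ∈ (Nat.rec f (fun i IH => IH.bind (g i)) m : Part ℕ)) ↔
      ∃ F : ℕ → ℕ, F 0 ∈ f ∧ (∀ i, i < m → F (i + 1) ∈ g i (F i)) ∧ y = F m := by
    induction m generalizing y with
    | zero => exact ⟨fun h => ⟨fun _ => y, h, by simp, rfl⟩, fun ⟨F, h, _, e⟩ => e ▸ h⟩
    | succ m ih =>
      simp only [Part.mem_bind_iff, ih]
      constructor
      · rintro ⟨z, ⟨F, h0, hF, rfl⟩, hy⟩
        refine ⟨fun i => if i ≤ m then F i else y, by simpa using h0, fun i hi => ?_, by simp⟩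
        rcases Nat.lt_succ_iff_lt_or_eq.1 hi with hi | rfl
        · simpa [hi.le, Nat.succ_le_of_lt hi] using hF i hi
        · simpa using hy
      · rintro ⟨F, h0, hF, rfl⟩
        exact ⟨F m, ⟨F, h0, fun i hi => hF i (hi.trans (Nat.lt_succ_self m)), rfl⟩,
          hF m (Nat.lt_succ_self m)⟩
  rw [key]
  constructor
  · rintro ⟨F, h0, hF, rfl⟩
    obtain ⟨c, hc⟩ := Nat.exists_beta F m
    refine ⟨c, ⟨by rwa [hc 0 (Nat.zero_le _)], fun i hi => ?_⟩, (hc m le_rfl).symm⟩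
    rw [hc _ hi.le, hc _ hi]
    exact hF i hi
  · rintro ⟨c, ⟨h0, hc⟩, rfl⟩
    exact ⟨Nat.beta c, h0, hc, rfl⟩

/-- The graph of every partial recursive function is arithmetical. -/
theorem ArithDef.of_nat_partrec {f : ℕ →. ℕ} (hf : Nat.Partrec f) :
    ArithDef fun w : Fin 2 → ℕ => w 1 ∈ f (w 0) := by
  induction hf with
  | zero => exact (ArithDef.eq (.var 1) (.const 0)).of_iff fun v => by simp [pure, PFun.pure]
  | succ => exact (ArithDef.eq (.var 1) ((ArithFun.var 0).add (.const 1))).of_iff fun v => by simp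
  | left => exact (ArithDef.eq (.var 1) (ArithFun.var 0).unpair_fst).of_iff fun v => by simp
  | right => exact (ArithDef.eq (.var 1) (ArithFun.var 0).unpair_snd).of_iff fun v => by simp
  | @pair f g _ _ hf hg =>
    refine (exists_nat (P := fun w a => ∃ b, (a ∈ f (w 0) ∧ b ∈ g (w 0)) ∧ w 1 = Nat.pair a b)
      (.exists_nat (.and (.and ?_ ?_) ?_))).of_iff fun v => ?_
    · exact .rel₂ (R := fun x y => y ∈ f x) hf (.var _) (.var _)
    · exact .rel₂ (R := fun x y => y ∈ g x) hg (.var _) (.var _)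
    · exact .eq (.var _) (.natPair (.var _) (.var _))
    · simp [Seq.seq]
      grind
  | @comp f g _ _ hf hg =>
    refine (exists_nat (P := fun w a => a ∈ g (w 0) ∧ w 1 ∈ f a) (.and ?_ ?_)).of_iff
      fun v => ?_
    · exact .rel₂ (R := fun x y => y ∈ g x) hg (.var _) (.var _)
    · exact .rel₂ (R := fun x y => y ∈ f x) hf (.var _) (.var _)
    · exact Part.mem_bind_iff.symm
  | @prec f g _ _ hf hg =>
    refine (exists_nat (P := fun w c => (Nat.beta c 0 ∈ f (w 0).unpair.1 ∧
        ∀ i, i < (w 0).unpair.2 → Nat.beta c (i + 1) ∈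
          g (Nat.pair (w 0).unpair.1 (Nat.pair i (Nat.beta c i)))) ∧
        w 1 = Nat.beta c (w 0).unpair.2)
      (.and (.and ?_ (.forall_nat (.imp ?_ ?_))) ?_)).of_iff fun v => ?_
    · exact .rel₂ (R := fun x y => y ∈ f x) hf (.unpair_fst (.var _)) (.beta (.var _) (.const 0))
    · exact .lt (.var _) (.unpair_snd (.var _))
    · exact .rel₂ (R := fun x y => y ∈ g x) hg
        (.natPair (.unpair_fst (.var _)) (.natPair (.var _) (.beta (.var _) (.var _))))
        (.beta (.var _) (.add (.var _) (.const 1)))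
    · exact .eq (.var _) (.beta (.var _) (.unpair_snd (.var _)))
    · exact (Part.mem_natRec (g := fun i x =>
        g (Nat.pair (v 0).unpair.1 (Nat.pair i x)))).symm
  | @rfind f _ hf =>
    refine (ArithDef.and (P := fun w => 0 ∈ f (Nat.pair (w 0) (w 1)))
      (Q := fun w => ∀ m, m < w 1 → ∃ y, y ∈ f (Nat.pair (w 0) m) ∧ ¬ y = 0)
      ?_ (.forall_nat (.imp ?_ (.exists_nat (.and ?_ (.not ?_)))))).of_iff fun v => ?_
    · exact .rel₂ (R := fun x y => y ∈ f x) hf (.natPair (.var _) (.var _)) (.const 0)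
    · exact .lt (.var _) (.var _)
    · exact .rel₂ (R := fun x y => y ∈ f x) hf (.natPair (.var _) (.var _)) (.var _)
    · exact .eq (.var _) (.const 0)
    · refine Iff.trans ?_ Nat.mem_rfind.symm
      simp

/-! ### Recursively enumerable sets of integer tuples. -/

/-- The integer coded by a natural number. -/
def natToInt (k : ℕ) : ℤ := Equiv.intEquivNat.symm k

/-- The code is zigzag: 2m stands for m and 2m + 1 for -m - 1. Both cases become linear equations,
which makes the decoding definable in ℤ. -/
theorem two_mul_natToInt_or (z : ℤ) (k : ℕ) :
    z = natToInt k ↔ 2 * z = k ∨ 2 * z = -(k + 1) := by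
  have h := Nat.even_or_odd' k
  obtain ⟨m, rfl | rfl⟩ := h
  · have : natToInt (2 * m) = m := by
      rw [natToInt, Equiv.symm_apply_eq]; rfl
    rw [this]; push_cast; omega
  · have : natToInt (2 * m + 1) = Int.negSucc m := by
      rw [natToInt, Equiv.symm_apply_eq]; rfl
    rw [this]; push_cast; omega

/-- A recursively enumerable set of tuples of integers is definable in `ℤ`. -/
theorem IntDefinable.of_rePred {m : ℕ} {P : (Fin m → ℤ) → Prop} (hP : REPred P) :
    IntDefinable P := by
  have hdec : Computable fun k : ℕ => fun i : Fin m => natToInt (Nat.beta k i) := by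
    have h1 : Primrec₂ fun (k : ℕ) (i : Fin m) => Nat.beta k i :=
      Primrec.nat_mod.comp (Primrec.fst.comp (Primrec.unpair.comp Primrec.fst))
        (Primrec.succ.comp (Primrec.nat_mul.comp
          (Primrec.succ.comp (Primrec.fin_val.comp Primrec.snd))
          (Primrec.snd.comp (Primrec.unpair.comp Primrec.fst))))
    have h2 : Primrec natToInt := Primrec.ofNat ℤ
    exact (Primrec.fin_curry.2 (h2.comp₂ h1)).to_comp
  -- This partial function halts, with value 0, exactly when the tuple decoded from `k` satisfies
  -- `P`; so `P` is read off from an arithmetical graph.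
  have hre : Partrec fun k : ℕ => Part.assert (P fun i => natToInt (Nat.beta k i)) fun _ =>
      Part.some 0 := by
    refine ((Partrec.comp hP hdec).map (g := fun _ _ => 0) (Computable.const 0).to₂).of_eq
      fun k => ?_
    ext
    simp [eq_comm]
  have h := ArithDef.of_nat_partrec (Partrec.nat_iff.1 hre)
  have h2 : ArithDef fun w : Fin m → ℕ => P fun i => natToInt (w i) := by
    refine (ArithDef.exists_nat (P := fun w k => (∀ i : Fin m, w i = Nat.beta k i) ∧
      0 ∈ Part.assert (P fun i : Fin m => natToInt (Nat.beta k i)) fun _ => Part.some 0)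
      (.and (.forall_index fun i => ?_) ?_)).of_iff fun w => ?_
    · exact .eq (.var (some i)) (.beta (.var none) (.const i))
    · exact .rel₂ (R := fun k y => y ∈ Part.assert (P fun i : Fin m => natToInt (Nat.beta k i))
        fun _ => Part.some 0) h (.var none) (.const 0)
    · simp only [Part.mem_assert_iff, Part.mem_some_iff, exists_prop, and_true]
      constructor
      · rintro ⟨k, hk, h⟩
        simpa only [hk] using h
      · intro h
        obtain ⟨k, hk⟩ := Nat.exists_beta (fun i => if h : i < m then w ⟨i, h⟩ else 0) m
        have : ∀ i : Fin m, w i = Nat.beta k i := fun i => by simp [hk i i.2.le]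
        exact ⟨k, this, by simpa only [← this] using h⟩
  obtain ⟨Q, hQ, hQP⟩ := h2
  -- Here `w` is the tuple of zigzag codes of the entries of `v`.
  refine (exists_tuple (β := Fin m) (P := fun v w => ((∀ i, 0 ≤ w i) ∧
    ∀ i, (v i + v i = w i ∨ v i + v i = -(w i + 1))) ∧ Q w)
    (.and (.and (.forall_index fun i => .nonneg _)
      (.forall_index fun i => .or ?_ ?_)) (hQ.comp Sum.inr))).of_iff fun v => ⟨?_, fun hv => ?_⟩
  · exact .eq (.add (.var _) (.var _)) (.var _)
  · exact .eq (.add (.var _) (.var _)) (.neg (.add (.var _) (.intCast 1)))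
  · rintro ⟨w, ⟨h0, hw⟩, h⟩
    choose k hk using fun i => Int.eq_ofNat_of_zero_le (h0 i)
    obtain rfl : w = fun i => (k i : ℤ) := funext hk
    have : v = fun i => natToInt (k i) :=
      funext fun i => (two_mul_natToInt_or _ _).2 (by simpa only [two_mul] using hw i)
    rw [this]
    exact (hQP k).1 h
  · refine ⟨fun i => (Equiv.intEquivNat (v i) : ℤ), ⟨fun i => by simp, fun i => ?_⟩, ?_⟩
    · rw [← two_mul, ← two_mul_natToInt_or]
      simp [natToInt]
    · rw [hQP fun i => Equiv.intEquivNat (v i)]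
      simpa [natToInt] using hv

end Arithmetic

/-! ### Laurent polynomials -/

namespace Laurent

variable {n : ℕ}

/-- The monomial `a ^ α`. -/
noncomputable def mono (α : Fin n → ℤ) : Laurent n := AddMonoidAlgebra.single α 1

/-- The variable `aᵢ`. -/
noncomputable def gen (i : Fin n) : Laurent n := mono (Pi.single i 1)

theorem mono_zero : mono (0 : Fin n → ℤ) = 1 := rfl

theorem mono_add (α β : Fin n → ℤ) : mono (α + β) = mono α * mono β := by
  simp [mono, AddMonoidAlgebra.single_mul_single]

theorem sum_zsmul_mono (Q : Laurent n) : (Q.coeff.sum fun α m => m • mono α) = Q := by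
  conv_rhs => rw [← AddMonoidAlgebra.sum_coeff_single Q]
  refine Finsupp.sum_congr fun α _ => ?_
  simp [mono, AddMonoidAlgebra.smul_single]

theorem mono_mul_mono_neg (α : Fin n → ℤ) : mono α * mono (-α) = 1 := by
  rw [← mono_add, add_neg_cancel, mono_zero]

theorem mono_injective : Function.Injective (mono : (Fin n → ℤ) → Laurent n) :=
  AddMonoidAlgebra.single_left_injective one_ne_zero

theorem gen_sub_one_ne_zero (i : Fin n) : gen i - 1 ≠ 0 := by
  rw [sub_ne_zero, ← mono_zero]
  intro h
  have := congrFun (mono_injective h) i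
  simp at this

/-- The Laurent polynomials in the first `m` variables. -/
noncomputable def restricted (n m : ℕ) : Subring (Laurent n) where
  carrier := {Q | ∀ α ∈ Q.coeff.support, ∀ k : Fin n, m ≤ k → α k = 0}
  mul_mem' {P Q} hP hQ α hα k hk := by
    classical
    obtain ⟨β, hβ, γ, hγ, rfl⟩ := Finset.mem_add.1
      (AddMonoidAlgebra.support_coeff_mul_subset P Q hα)
    simp [hP β hβ k hk, hQ γ hγ k hk]
  one_mem' α hα k hk := by
    rw [AddMonoidAlgebra.one_def] at hα
    simp at hα
    simp [hα]
  add_mem' {P Q} hP hQ α hα k hk := by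
    classical
    rcases Finset.mem_union.1 (Finsupp.support_add hα) with h | h
    · exact hP α h k hk
    · exact hQ α h k hk
  zero_mem' := by simp
  neg_mem' {P} hP α hα k hk := by
    refine hP α ?_ k hk
    simpa using hα

theorem mem_restricted {m : ℕ} {Q : Laurent n} :
    Q ∈ restricted n m ↔ ∀ α ∈ Q.coeff.support, ∀ k : Fin n, m ≤ k → α k = 0 := Iff.rfl

theorem restricted_mono {m m' : ℕ} (h : m ≤ m') : restricted n m ≤ restricted n m' :=
  fun _ hQ α hα k hk => hQ α hα k (h.trans hk)

theorem mono_mem_restricted {m : ℕ} {α : Fin n → ℤ} :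
    mono α ∈ restricted n m ↔ ∀ k : Fin n, m ≤ k → α k = 0 := by
  simp [mem_restricted, mono]

theorem gen_mem_restricted {m : ℕ} {i : Fin n} (h : (i : ℕ) < m) : gen i ∈ restricted n m := by
  refine mono_mem_restricted.2 fun k hk => ?_
  rw [Pi.single_eq_of_ne]
  rintro rfl
  omega

theorem isRestricted_iff {β : LowerPair n → Laurent n} :
    IsRestricted β ↔ ∀ p : LowerPair n, β p ∈ restricted n (p.1.1 + 1) :=
  forall_congr' fun _ => forall₂_congr fun _ _ => Iff.rfl

/-- Laurent polynomials in the first `m` variables are sums of monomials and their negatives. -/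
theorem restricted_induction {m : ℕ} {p : Laurent n → Prop} (zero : p 0)
    (add : ∀ P Q, p P → p Q → p (P + Q)) (neg : ∀ P, p P → p (-P))
    (mono : ∀ α : Fin n → ℤ, (∀ k : Fin n, m ≤ k → α k = 0) → p (mono α)) {Q : Laurent n}
    (hQ : Q ∈ restricted n m) : p Q := by
  let S : AddSubgroup (Laurent n) :=
    { carrier := {Q | p Q}
      add_mem' := fun h h' => add _ _ h h'
      zero_mem' := zero
      neg_mem' := fun h => neg _ h }
  change Q ∈ S
  rw [← sum_zsmul_mono Q]
  refine AddSubgroup.sum_mem _ fun α hα => ?_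
  exact S.zsmul_mem (mono α (hQ α hα)) _

theorem mem_restricted_self (Q : Laurent n) : Q ∈ restricted n n :=
  fun _ _ k hk => absurd k.2 (not_lt.2 hk)

/-- The specialization `aᵢ = 1`. -/
noncomputable def specialize (i : Fin n) : Laurent n →+* Laurent n :=
  AddMonoidAlgebra.mapDomainRingHom ℤ
    ({ toFun := fun α => Function.update α i 0
       map_zero' := by simp
       map_add' := fun α β => by
        ext k; by_cases h : k = i
        · subst h; simp
        · simp [h] } : (Fin n → ℤ) →+ (Fin n → ℤ))

theorem specialize_mono (i : Fin n) (α : Fin n → ℤ) :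
    specialize i (mono α) = mono (Function.update α i 0) := by
  simp [specialize, mono]

theorem specialize_gen (i : Fin n) : specialize i (gen i) = 1 := by
  rw [gen, specialize_mono, ← mono_zero]
  congr 1
  ext k
  by_cases h : k = i
  · subst h; simp
  · simp [h]

theorem specialize_eq_self {i : Fin n} {Q : Laurent n} (hQ : Q ∈ restricted n i) :
    specialize i Q = Q := by
  refine restricted_induction (p := fun Q => specialize i Q = Q) (map_zero _)
    (fun P Q hP hQ => by rw [map_add, hP, hQ]) (fun P hP => by rw [map_neg, hP])
    (fun α hα => ?_) hQ
  rw [specialize_mono, Function.update_eq_self_iff.2 (hα i le_rfl).symm]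

/-- Setting aᵢ = 1 kills the product but fixes every polynomial free of aᵢ, so the product is zero
in a domain. Indices start at 0: `restricted n i` excludes aᵢ itself, while `restricted n (i + 1)`
admits it. -/
theorem eq_zero_of_mul_gen_sub_one_mem {i : Fin n} {Q : Laurent n}
    (h : Q * (gen i - 1) ∈ restricted n i) : Q = 0 := by
  have h1 := specialize_eq_self h
  rw [map_mul, map_sub, specialize_gen, map_one, sub_self, mul_zero] at h1
  exact (mul_eq_zero.1 h1.symm).resolve_right (gen_sub_one_ne_zero i)

/-- `aᵢ ^ t - 1` is a multiple of `aᵢ - 1`. -/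
theorem exists_mono_single_sub_one (i : Fin n) (t : ℤ) :
    ∃ q ∈ restricted n (i + 1), mono (Pi.single i t) - 1 = q * (gen i - 1) := by
  have hs : ∀ t : ℤ, mono (Pi.single i t : Fin n → ℤ) ∈ restricted n (i + 1) := fun t => by
    refine mono_mem_restricted.2 fun k hk => Pi.single_eq_of_ne ?_ _
    rintro rfl
    omega
  have hadd : ∀ t, (mono (Pi.single i (t + 1)) : Laurent n) = mono (Pi.single i t) * gen i :=
    fun t => by rw [Pi.single_add, mono_add]; rfl
  induction t using Int.induction_on with
  | zero => exact ⟨0, zero_mem _, by rw [Pi.single_zero, mono_zero]; simp⟩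
  | succ t ih =>
    obtain ⟨q, hq, h⟩ := ih
    refine ⟨q + mono (Pi.single i (t : ℤ)), add_mem hq (hs _), ?_⟩
    rw [hadd, add_mul, ← h]
    ring
  | pred t ih =>
    obtain ⟨q, hq, h⟩ := ih
    refine ⟨q - mono (Pi.single i (-t - 1 : ℤ)), sub_mem hq (hs _), ?_⟩
    have := hadd (-t - 1)
    rw [sub_add_cancel] at this
    rw [sub_mul, ← h, this]
    ring

/-! ### Uniqueness of restricted relations -/

/-- The Koszul relation `eᵢ (aⱼ - 1) - eⱼ (aᵢ - 1)`. -/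
noncomputable def koszul (p : LowerPair n) : Fin n → Laurent n :=
  Pi.single p.1.1 (gen p.1.2 - 1) - Pi.single p.1.2 (gen p.1.1 - 1)

theorem koszul_mem_restricted (p : LowerPair n) (k : Fin n) :
    koszul p k ∈ restricted n (p.1.1 + 1) := by
  have h1 : (gen p.1.2 - 1 : Laurent n) ∈ restricted n (p.1.1 + 1) :=
    sub_mem (gen_mem_restricted (Nat.lt_succ_of_lt p.2)) (one_mem _)
  have h2 : (gen p.1.1 - 1 : Laurent n) ∈ restricted n (p.1.1 + 1) :=
    sub_mem (gen_mem_restricted (Nat.lt_succ_self _)) (one_mem _)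
  simp only [koszul, Pi.sub_apply, Pi.single_apply]
  refine sub_mem ?_ ?_ <;> split_ifs <;> first | assumption | exact zero_mem _

/-- Descending induction on the larger index i of the pair p = (i, j), reading the relation in
coordinate j. The pair p contributes -βᵢⱼ (aᵢ - 1). Pairs of larger first index vanish by induction,
the other pairs (i, j') do not meet coordinate j, and pairs of smaller first index contribute
polynomials free of aᵢ. Hence βᵢⱼ (aᵢ - 1) is free of aᵢ, which forces βᵢⱼ = 0. -/
theorem eq_zero_of_sum_koszul_eq_zero {β : LowerPair n → Laurent n} (hβ : IsRestricted β)
    (h : ∑ p, β p • koszul p = 0) : β = 0 := by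
  rw [isRestricted_iff] at hβ
  have key : ∀ i : Fin n, ∀ p : LowerPair n, p.1.1 = i → β p = 0 := by
    intro i
    induction i using (wellFounded_gt (α := Fin n)).induction with
    | _ i ih =>
    rintro p rfl
    refine eq_zero_of_mul_gen_sub_one_mem (i := p.1.1) ?_
    have h1 := congrFun h p.1.2
    rw [Finset.sum_apply, ← Finset.add_sum_erase _ _ (Finset.mem_univ p)] at h1
    have h2 : (β p • koszul p) p.1.2 = -(β p * (gen p.1.1 - 1)) := by
      simp [koszul, p.2.ne]
      ring
    rw [h2, Pi.zero_apply, neg_add_eq_zero] at h1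
    rw [h1]
    refine sum_mem fun q hq => ?_
    rcases lt_trichotomy q.1.1 p.1.1 with hlt | heq | hgt
    · exact mul_mem (restricted_mono hlt (hβ q)) (restricted_mono hlt (koszul_mem_restricted q _))
    · have hne : p.1.2 ≠ q.1.2 := fun h =>
        Finset.ne_of_mem_erase hq (Subtype.ext (Prod.ext heq h.symm))
      have h0 : koszul q p.1.2 = 0 := by
        rw [koszul, heq]
        simp [p.2.ne, hne]
      rw [Pi.smul_apply, h0, smul_zero]
      exact zero_mem _
    · rw [ih _ hgt q rfl, zero_smul]
      exact zero_mem _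
  exact funext fun p => key _ p rfl

end Laurent

/-! ### The Magnus group -/

section FreeMetabelian

open Laurent

/-- The semidirect product of `ℤⁿ` and the free module of rank `n` over the Laurent polynomials. -/
@[ext]
structure MagnusGroup (n : ℕ) where
  /-- the component in `ℤⁿ` -/
  deg : Fin n → ℤ
  /-- the component in the free module -/
  vec : Fin n → Laurent n

namespace MagnusGroup

variable {n : ℕ}

/-- The degree of the right factor acts, so that u ↦ g⁻¹ u g multiplies the vector of a degree 0
element u by the monomial of g, in agreement with u ^ Q. -/
noncomputable instance : Mul (MagnusGroup n) :=
  ⟨fun g h => ⟨g.deg + h.deg, mono h.deg • g.vec + h.vec⟩⟩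

noncomputable instance : One (MagnusGroup n) := ⟨⟨0, 0⟩⟩

noncomputable instance : Inv (MagnusGroup n) := ⟨fun g => ⟨-g.deg, -(mono (-g.deg) • g.vec)⟩⟩

@[simp] theorem mul_deg (g h : MagnusGroup n) : (g * h).deg = g.deg + h.deg := rfl
@[simp] theorem mul_vec (g h : MagnusGroup n) : (g * h).vec = mono h.deg • g.vec + h.vec := rfl
@[simp] theorem one_deg : (1 : MagnusGroup n).deg = 0 := rfl
@[simp] theorem one_vec : (1 : MagnusGroup n).vec = 0 := rfl
@[simp] theorem inv_deg (g : MagnusGroup n) : g⁻¹.deg = -g.deg := rfl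
@[simp] theorem inv_vec (g : MagnusGroup n) : g⁻¹.vec = -(mono (-g.deg) • g.vec) := rfl

noncomputable instance : Group (MagnusGroup n) :=
  Group.ofLeftAxioms
    (fun a b c => by
      ext1
      · exact add_assoc _ _ _
      · simp only [mul_vec, mul_deg, smul_add, smul_smul, mono_add, add_assoc]
        rw [mul_comm (mono b.deg)])
    (fun a => by ext1 <;> simp)
    (fun a => by
      ext1
      · simp
      · simp only [mul_vec, inv_vec, smul_neg, smul_smul, mono_mul_mono_neg, one_smul, one_vec,
          neg_add_cancel])

/-- The projection to `ℤⁿ`. -/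
noncomputable def degHom : MagnusGroup n →* Multiplicative (Fin n → ℤ) where
  toFun g := Multiplicative.ofAdd g.deg
  map_one' := rfl
  map_mul' _ _ := rfl

/-- Elements of the derived subgroup have degree 0, and in degree 0 multiplication is addition of
vectors. -/
theorem derivedSeries_two : derivedSeries (MagnusGroup n) 2 = ⊥ := by
  have h : ∀ g ∈ derivedSeries (MagnusGroup n) 1, g.deg = 0 := fun g hg => by
    rw [derivedSeries_one] at hg
    exact Abelianization.commutator_subset_ker degHom hg
  rw [derivedSeries_succ, Subgroup.commutator_eq_bot_iff_le_centralizer]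
  intro g hg
  rw [Subgroup.mem_centralizer_iff]
  intro k hk
  ext1
  · exact add_comm _ _
  · simp [h g hg, h k hk, mono_zero, add_comm]

/-- The images of the free generators. -/
noncomputable def gen (i : Fin n) : MagnusGroup n := ⟨Pi.single i 1, Pi.single i 1⟩

/-- The elements supported in coordinate i and satisfying the Fox-type identity vecᵢ (aᵢ - 1) = a ^
deg - 1 form a subgroup, so all integer powers are covered at once. -/
theorem zpow_gen (i : Fin n) (t : ℤ) : (gen i ^ t).deg = Pi.single i t ∧
    (∀ k, k ≠ i → (gen i ^ t).vec k = 0) ∧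
      (gen i ^ t).vec i * (Laurent.gen i - 1) = mono (Pi.single i t) - 1 := by
  let S : Subgroup (MagnusGroup n) :=
    { carrier := {g | (∀ k, k ≠ i → g.vec k = 0) ∧
        g.vec i * (Laurent.gen i - 1) = mono g.deg - 1}
      one_mem' := by simp [mono_zero]
      mul_mem' := by
        rintro g h ⟨hg, hg'⟩ ⟨hh, hh'⟩
        refine ⟨fun k hk => by simp [hg k hk, hh k hk], ?_⟩
        simp only [mul_vec, mul_deg, Pi.add_apply, Pi.smul_apply, smul_eq_mul, add_mul, mul_assoc,
          hg', hh', mono_add]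
        ring
      inv_mem' := by
        rintro g ⟨hg, hg'⟩
        refine ⟨fun k hk => by simp [hg k hk], ?_⟩
        simp only [inv_vec, inv_deg, Pi.neg_apply, Pi.smul_apply, smul_eq_mul, neg_mul, mul_assoc,
          hg']
        linear_combination -mono_mul_mono_neg g.deg }
  have hd : (gen i ^ t).deg = Pi.single i t := by
    have := congrArg Multiplicative.toAdd (map_zpow degHom (gen i) t)
    refine this.trans ?_
    ext k
    by_cases h : k = i
    · subst h
      simp [degHom, gen]
    · simp [degHom, gen, h]
  have hS : gen i ^ t ∈ S := by
    refine Subgroup.zpow_mem _ (show _ ∧ _ from ⟨fun k hk => ?_, ?_⟩) _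
    · simp [gen, hk]
    · simp [gen, Laurent.gen]
  exact ⟨hd, hS.1, by rw [hS.2, hd]⟩

/-- Only the i-th power contributes to coordinate i, and the factors to its right multiply this
contribution by their monomials. So aᵢ ^ γᵢ - 1 gets multiplied by the monomial of the exponents
beyond i. -/
theorem prod_zpow_gen (γ : Fin n → ℤ) (L : List (Fin n)) (hL : L.Pairwise (· < ·)) :
    (L.map fun i => gen i ^ γ i).prod.deg = (fun k => if k ∈ L then γ k else 0) ∧
      ∀ i, (L.map fun i => gen i ^ γ i).prod.vec i * (Laurent.gen i - 1) =
        mono (fun k => if k ∈ L ∧ i ≤ k then γ k else 0) -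
          mono (fun k => if k ∈ L ∧ i < k then γ k else 0) := by
  induction L with
  | nil => exact ⟨by ext; simp, by simp⟩
  | cons a L ih =>
    rw [List.pairwise_cons] at hL
    obtain ⟨hdeg, hvec⟩ := ih hL.2
    obtain ⟨h1, h2, h3⟩ := zpow_gen a (γ a)
    have ha : a ∉ L := fun h => lt_irrefl _ (hL.1 a h)
    rw [List.map_cons, List.prod_cons]
    refine ⟨?_, fun i => ?_⟩
    · rw [mul_deg, hdeg, h1]
      ext k
      by_cases hk : k = a
      · subst hk; simp [ha]
      · simp [hk]
    · rw [mul_vec, Pi.add_apply, add_mul, hvec i, hdeg]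
      by_cases hi : i = a
      · subst hi
        rw [Pi.smul_apply, smul_eq_mul, mul_assoc, h3, mul_sub, ← mono_add, mul_one]
        have e1 : ((fun k => if k ∈ L then γ k else 0) + Pi.single i (γ i) : Fin n → ℤ) =
            fun k => if k ∈ i :: L ∧ i ≤ k then γ k else 0 := by
          ext k
          by_cases hk : k = i
          · subst hk; simp [ha]
          · by_cases hkL : k ∈ L
            · simp [hk, hkL, (hL.1 k hkL).le]
            · simp [hk, hkL]
        have e2 : (fun k => if k ∈ L then γ k else 0) =
            fun k => if k ∈ i :: L ∧ i < k then γ k else 0 := by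
          ext k
          by_cases hk : k = i
          · subst hk; simp [ha]
          · by_cases hkL : k ∈ L
            · simp [hkL, (hL.1 k hkL)]
            · simp [hk, hkL]
        have e3 : (fun k => if k ∈ L ∧ i ≤ k then γ k else 0) =
            fun k => if k ∈ L ∧ i < k then γ k else 0 := by
          ext k
          by_cases hkL : k ∈ L
          · simp [hkL, (hL.1 k hkL), (hL.1 k hkL).le]
          · simp [hkL]
        rw [e1, ← e2, e3]
        ring
      · rw [Pi.smul_apply, h2 i hi, smul_zero, zero_mul, zero_add]
        rcases lt_or_gt_of_ne hi with hlt | hgt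
        · have h4 : ∀ k ∈ a :: L, i < k := fun k hk => by
            rcases List.mem_cons.1 hk with rfl | hk
            · exact hlt
            · exact hlt.trans (hL.1 k hk)
          have e1 : ∀ k, k ∈ L ∧ i ≤ k ↔ k ∈ L ∧ i < k := fun k =>
            and_congr_right fun hk => by simp [h4 k (List.mem_cons_of_mem _ hk),
              (h4 k (List.mem_cons_of_mem _ hk)).le]
          have e2 : ∀ k, k ∈ a :: L ∧ i ≤ k ↔ k ∈ a :: L ∧ i < k := fun k =>
            and_congr_right fun hk => by simp [h4 k hk, (h4 k hk).le]
          simp only [e1, e2, sub_self]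
        · have e1 : ∀ k, k ∈ L ∧ i ≤ k ↔ k ∈ a :: L ∧ i ≤ k := fun k =>
            and_congr_left fun hk => by simp [(hgt.trans_le hk).ne']
          have e2 : ∀ k, k ∈ L ∧ i < k ↔ k ∈ a :: L ∧ i < k := fun k =>
            and_congr_left fun hk => by simp [(hgt.trans hk).ne']
          simp only [e1, e2]

end MagnusGroup

/-! ### The Magnus homomorphism and its values on normal forms. -/

section MagnusMap

open scoped IsMulCommutative

variable {G : Type u} [Group G] {n : ℕ} {x : Fin n → G}

/-- The Magnus group is metabelian, so F'' dies in it. -/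
theorem IsFreeMetabelianBasis.ker_le (hx : IsFreeMetabelianBasis x) :
    (FreeGroup.lift x).ker ≤ (FreeGroup.lift (MagnusGroup.gen (n := n))).ker := by
  rw [hx.2, ← MonoidHom.comap_bot, ← MagnusGroup.derivedSeries_two, ← Subgroup.map_le_iff_le_comap]
  exact map_derivedSeries_le_derivedSeries _ 2

/-- The Magnus homomorphism of a free metabelian group with a chosen basis. -/
noncomputable def magnusMap (hx : IsFreeMetabelianBasis x) : G →* MagnusGroup n :=
  (FreeGroup.lift x).liftOfSurjective hx.1 ⟨FreeGroup.lift MagnusGroup.gen, hx.ker_le⟩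

theorem magnusMap_basis (hx : IsFreeMetabelianBasis x) (i : Fin n) :
    magnusMap hx (x i) = MagnusGroup.gen i := by
  have := MonoidHom.liftOfRightInverse_comp_apply (FreeGroup.lift x) _
    (Function.rightInverse_surjInv hx.1) ⟨FreeGroup.lift MagnusGroup.gen, hx.ker_le⟩
    (FreeGroup.of i)
  rwa [FreeGroup.lift_apply_of, FreeGroup.lift_apply_of] at this

theorem magnusMap_orderedPower (hx : IsFreeMetabelianBasis x) (γ : Fin n → ℤ) :
    (magnusMap hx (orderedPower x γ)).deg = γ ∧
      ∀ i, (magnusMap hx (orderedPower x γ)).vec i * (gen i - 1) =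
        mono (fun k => if i ≤ k then γ k else 0) - mono (fun k => if i < k then γ k else 0) := by
  have h := MagnusGroup.prod_zpow_gen γ (List.finRange n) (List.pairwise_lt_finRange n)
  have e : magnusMap hx (orderedPower x γ) =
      ((List.finRange n).map fun i => MagnusGroup.gen i ^ γ i).prod := by
    rw [orderedPower, List.ofFn_eq_map, map_list_prod, List.map_map]
    congr 2
    ext1 i
    simp [magnusMap_basis]
  rw [e]
  simpa using h

theorem magnusMap_commutator_deg (hx : IsFreeMetabelianBasis x) (u : commutator G) :
    (magnusMap hx u).deg = 0 :=
  Abelianization.commutator_subset_ker (MagnusGroup.degHom.comp (magnusMap hx)) u.2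

/-- The restriction of the Magnus homomorphism to the commutator subgroup. -/
noncomputable def magnusVec (hx : IsFreeMetabelianBasis x) :
    commutator G →* Multiplicative (Fin n → Laurent n) where
  toFun u := Multiplicative.ofAdd (magnusMap hx u).vec
  map_one' := by simp
  map_mul' u v := by
    simp [magnusMap_commutator_deg, mono_zero]

theorem magnusMap_laurentPower [IsMetabelian G] (hx : IsFreeMetabelianBasis x) (u : commutator G)
    (Q : Laurent n) : (magnusMap hx (laurentPower x u Q)).vec = Q • (magnusMap hx u).vec := by
  have h1 : ∀ α, magnusVec hx (MulAut.conjNormal (orderedPower x α)⁻¹ u) =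
      Multiplicative.ofAdd (mono α • (magnusMap hx u).vec) := by
    intro α
    change Multiplicative.ofAdd _ = _
    congr 1
    have hd := (magnusMap_orderedPower hx α).1
    ext1 k
    simp [magnusMap_commutator_deg, hd, mono_zero, ← mul_assoc, ← mono_add]
  change (magnusVec hx (laurentPower x u Q)).toAdd = _
  rw [laurentPower, map_finsuppProd]
  conv_rhs => rw [← sum_zsmul_mono Q]
  simp only [map_zpow, h1, Finsupp.prod, Finsupp.sum, toAdd_prod, toAdd_zpow, toAdd_ofAdd,
    Finset.sum_smul, smul_assoc]

theorem magnusMap_normalForm [IsMetabelian G] (hx : IsFreeMetabelianBasis x) (γ : Fin n → ℤ)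
    (β : LowerPair n → Laurent n) :
    (magnusMap hx (normalForm x γ β)).deg = γ ∧
      (magnusMap hx (normalForm x γ β)).vec =
        (magnusMap hx (orderedPower x γ)).vec + ∑ p, β p • koszul p := by
  have h1 : ∀ p : LowerPair n,
      (magnusMap hx (rightCommutator (x p.1.1) (x p.1.2) : commutator G)).vec = koszul p := by
    intro p
    -- Comparing xᵢ xⱼ with xⱼ xᵢ determines the vector of the commutator without computing
    -- inverses.
    have h := congrArg MagnusGroup.vec (congrArg (magnusMap hx)
      (show x p.1.2 * x p.1.1 * (rightCommutator (x p.1.1) (x p.1.2) : commutator G) =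
        x p.1.1 * x p.1.2 by simp [rightCommutator]; group))
    rw [map_mul, MagnusGroup.mul_vec, magnusMap_commutator_deg, mono_zero, one_smul, map_mul,
      map_mul, magnusMap_basis, magnusMap_basis, MagnusGroup.mul_vec, MagnusGroup.mul_vec,
      ← eq_sub_iff_add_eq'] at h
    rw [h]
    ext1 k
    by_cases h1 : k = p.1.1
    · simp [koszul, MagnusGroup.gen, gen, h1, p.2.ne']
    · by_cases h2 : k = p.1.2
      · simp [koszul, MagnusGroup.gen, gen, h2, p.2.ne]
      · simp [koszul, MagnusGroup.gen, h1, h2]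
  have h2 := congrArg Multiplicative.toAdd (map_prod (magnusVec hx)
    (fun p : LowerPair n => laurentPower x (rightCommutator (x p.1.1) (x p.1.2)) (β p)) Finset.univ)
  rw [toAdd_prod] at h2
  constructor
  · rw [normalForm, map_mul, MagnusGroup.mul_deg, magnusMap_commutator_deg, add_zero,
      (magnusMap_orderedPower hx γ).1]
  · rw [normalForm, map_mul, MagnusGroup.mul_vec, magnusMap_commutator_deg, mono_zero, one_smul]
    congr 1
    refine h2.trans (Finset.sum_congr rfl fun p _ => ?_)
    exact (magnusMap_laurentPower hx _ _).trans (by rw [h1])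

/-- The hypothesis is equality of Magnus images only, since injectivity of the Magnus map is not yet
available. Degrees give γ, and then the ordered powers cancel and leave a Koszul relation. -/
theorem normalForm_injective [IsMetabelian G] (hx : IsFreeMetabelianBasis x) {γ γ' : Fin n → ℤ}
    {β β' : LowerPair n → Laurent n} (hβ : IsRestricted β) (hβ' : IsRestricted β')
    (h : magnusMap hx (normalForm x γ β) = magnusMap hx (normalForm x γ' β')) :
    γ = γ' ∧ β = β' := by
  obtain ⟨h1, h2⟩ := magnusMap_normalForm hx γ β
  obtain ⟨h1', h2'⟩ := magnusMap_normalForm hx γ' β'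
  have hγ : γ = γ' := by rw [← h1, ← h1', h]
  refine ⟨hγ, sub_eq_zero.1 (eq_zero_of_sum_koszul_eq_zero (β := β - β') ?_ ?_)⟩
  · rw [isRestricted_iff] at *
    exact fun p => sub_mem (hβ p) (hβ' p)
  · rw [h, h2', hγ, add_right_inj] at h2
    simp [sub_smul, h2]

end MagnusMap

/-! ### Existence of normal forms -/

section Restriction

variable {n : ℕ} {M : Type*} [AddCommGroup M] [Module (Laurent n) M]

/-- The linear combinations of the family `c` with restricted coefficients. -/
noncomputable def restrictedSpan (c : Fin n → Fin n → M) : AddSubgroup M where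
  carrier := {m | ∃ β : LowerPair n → Laurent n, IsRestricted β ∧ m = ∑ p, β p • c p.1.1 p.1.2}
  add_mem' := by
    rintro _ _ ⟨β, hβ, rfl⟩ ⟨β', hβ', rfl⟩
    rw [isRestricted_iff] at hβ hβ'
    refine ⟨β + β', isRestricted_iff.2 fun p => add_mem (hβ p) (hβ' p), ?_⟩
    simp [add_smul, Finset.sum_add_distrib]
  zero_mem' := ⟨0, isRestricted_iff.2 fun _ => zero_mem _, by simp⟩
  neg_mem' := by
    rintro _ ⟨β, hβ, rfl⟩
    rw [isRestricted_iff] at hβ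
    refine ⟨-β, isRestricted_iff.2 fun p => neg_mem (hβ p), ?_⟩
    simp

theorem smul_mem_restrictedSpan_of_mem (c : Fin n → Fin n → M) (p : LowerPair n) {Q : Laurent n}
    (hQ : Q ∈ restricted n (p.1.1 + 1)) : Q • c p.1.1 p.1.2 ∈ restrictedSpan c := by
  classical
  refine ⟨Pi.single p Q, isRestricted_iff.2 fun q => ?_, ?_⟩
  · by_cases h : q = p
    · subst h; simpa using hQ
    · rw [Pi.single_eq_of_ne h]; exact zero_mem _
  · rw [Finset.sum_eq_single p (fun q _ h => by rw [Pi.single_eq_of_ne h, zero_smul])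
      (fun h => absurd (Finset.mem_univ p) h), Pi.single_eq_same]

variable {c : Fin n → Fin n → M}
  (hc : ∀ i j k, (gen k - 1 : Laurent n) • c i j = (gen i - 1 : Laurent n) • c k j -
    (gen j - 1 : Laurent n) • c k i)

-- Induction on the number m of variables allowed in the monomial. If it exceeds what the pair (i,
-- j) permits, split off the top variable: a ^ α = a ^ α' + a ^ α' q (aₘ - 1), with aₘ absent from
-- α'. The first term falls under induction. In the second, `hc` turns (aₘ - 1) cᵢⱼ into multiples
-- of cₘⱼ and cₘᵢ, for which aₘ is a permitted variable.
include hc in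
theorem mono_smul_mem_restrictedSpan (m : ℕ) (α : Fin n → ℤ) (hα : ∀ k : Fin n, m ≤ k → α k = 0)
    (p : LowerPair n) : mono α • c p.1.1 p.1.2 ∈ restrictedSpan c := by
  induction m generalizing α p with
  | zero =>
    exact smul_mem_restrictedSpan_of_mem c p (mono_mem_restricted.2 fun k _ => hα k (Nat.zero_le _))
  | succ m ih =>
    rcases le_or_gt m p.1.1 with h | h
    · exact smul_mem_restrictedSpan_of_mem c p
        (mono_mem_restricted.2 fun k hk => hα k (by omega))
    rcases le_or_gt n m with hm | hm
    -- There is no variable of index m, so nothing has to be removed.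
    · exact ih α (fun k hk => absurd k.2 (by omega)) p
    obtain ⟨q, hq, hq'⟩ := exists_mono_single_sub_one (⟨m, hm⟩ : Fin n) (α ⟨m, hm⟩)
    have hα' : ∀ k : Fin n, m ≤ k → Function.update α ⟨m, hm⟩ 0 k = 0 := fun k hk => by
      by_cases hk' : k = ⟨m, hm⟩
      · subst hk'; simp
      · rw [Function.update_of_ne hk']
        exact hα k (Nat.succ_le_of_lt (lt_of_le_of_ne hk fun h => hk' (Fin.ext h.symm)))
    have e : mono α = mono (Function.update α ⟨m, hm⟩ 0) +
        mono (Function.update α ⟨m, hm⟩ 0) * q * (gen ⟨m, hm⟩ - 1) := by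
      have : α = Function.update α ⟨m, hm⟩ 0 + Pi.single ⟨m, hm⟩ (α ⟨m, hm⟩) := by
        ext k
        by_cases hk' : k = ⟨m, hm⟩
        · subst hk'; simp
        · simp [hk']
      conv_lhs => rw [this, mono_add]
      rw [mul_assoc, ← hq']
      ring
    have hr : mono (Function.update α ⟨m, hm⟩ 0) * q ∈ restricted n (m + 1) :=
      mul_mem (mono_mem_restricted.2 fun k hk => hα' k (by omega)) hq
    have hg : ∀ i : Fin n, (i : ℕ) < m → (gen i - 1 : Laurent n) ∈ restricted n (m + 1) :=
      fun i hi => sub_mem (gen_mem_restricted (by omega)) (one_mem _)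
    have hp : (p.1.2 : ℕ) < p.1.1 := p.2
    rw [e, add_smul, mul_smul _ (gen _ - 1), hc, smul_sub, smul_smul, smul_smul]
    refine add_mem (ih _ hα' p) (sub_mem ?_ ?_)
    · exact smul_mem_restrictedSpan_of_mem c ⟨(⟨m, hm⟩, p.1.2), hp.trans h⟩
        (mul_mem hr (hg _ h))
    · exact smul_mem_restrictedSpan_of_mem c ⟨(⟨m, hm⟩, p.1.1), h⟩
        (mul_mem hr (hg _ (hp.trans h)))

-- By definition the span is only an additive group; the identity `hc` makes it a submodule.
include hc in
theorem smul_mem_restrictedSpan (Q : Laurent n) {u : M} (hu : u ∈ restrictedSpan c) :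
    Q • u ∈ restrictedSpan c := by
  obtain ⟨β, -, rfl⟩ := hu
  rw [Finset.smul_sum]
  refine sum_mem fun p _ => ?_
  rw [smul_smul]
  refine restricted_induction (p := fun Q : Laurent n => Q • c p.1.1 p.1.2 ∈ restrictedSpan c)
    ?_ ?_ ?_ ?_ (mem_restricted_self (Q * β p))
  · simp only [zero_smul, zero_mem]
  · exact fun P Q hP hQ => by simpa only [add_smul] using add_mem hP hQ
  · exact fun P hP => by simpa only [neg_smul] using neg_mem hP
  · exact fun α hα => mono_smul_mem_restrictedSpan hc n α hα p

end Restriction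

/-! ### The commutator subgroup as a Laurent module and its restricted generators. -/

section Existence

open scoped IsMulCommutative

variable {G : Type u} [Group G] {n : ℕ}

theorem map_orderedPower {H : Type*} [CommGroup H] (f : G →* H) (x : Fin n → G) (γ : Fin n → ℤ) :
    f (orderedPower x γ) = ∏ i, f (x i) ^ γ i := by
  rw [orderedPower, map_list_prod, List.map_ofFn, List.prod_ofFn]
  simp

/-- The class of `x₁ ^ γ₁ ⋯ xₙ ^ γₙ` in the abelianization, as a homomorphism. -/
noncomputable def orderedPowerHom (x : Fin n → G) :
    Multiplicative (Fin n → ℤ) →* Abelianization G where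
  toFun γ := Abelianization.of (orderedPower x γ.toAdd)
  map_one' := by simp [map_orderedPower]
  map_mul' γ δ := by simp [map_orderedPower, zpow_add, Finset.prod_mul_distrib]

theorem exists_orderedPower {x : Fin n → G} (hx : Function.Surjective (FreeGroup.lift x)) (g : G) :
    ∃ γ, Abelianization.of g = Abelianization.of (orderedPower x γ) := by
  have h : ∀ w : FreeGroup (Fin n),
      Abelianization.of (FreeGroup.lift x w) ∈ (orderedPowerHom x).range := by
    intro w
    induction w using FreeGroup.induction_on with
    | C1 => simp [one_mem]
    | of i =>
      refine ⟨Multiplicative.ofAdd (Pi.single i 1), ?_⟩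
      change Abelianization.of _ = _
      rw [map_orderedPower, Finset.prod_eq_single i] <;> simp +contextual
    | inv_of i h => simpa only [map_inv] using inv_mem h
    | mul v w hv hw => simpa only [map_mul] using mul_mem hv hw
  obtain ⟨w, rfl⟩ := hx g
  obtain ⟨γ, hγ⟩ := h w
  exact ⟨γ.toAdd, hγ.symm⟩

variable [IsMetabelian G]

/-- The commutator subgroup is abelian, hence acts trivially on itself by conjugation. -/
theorem conjNormal_eq_of_abelianization_eq {g h : G}
    (hgh : Abelianization.of g = Abelianization.of h) :
    (MulAut.conjNormal g : MulAut (commutator G)) = MulAut.conjNormal h := by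
  have hm : g⁻¹ * h ∈ commutator G := QuotientGroup.eq.1 hgh
  have h1 : (MulAut.conjNormal (g⁻¹ * h) : MulAut (commutator G)) = 1 := by
    ext u
    have := congrArg (Subtype.val) (mul_comm (⟨_, hm⟩ : commutator G) u)
    simp only [Subgroup.coe_mul] at this
    rw [MulAut.conjNormal_apply, this, mul_inv_cancel_right]
    rfl
  rw [map_mul, map_inv, inv_mul_eq_one] at h1
  exact h1

/-- The conjugation action of `ℤⁿ` on the commutator subgroup. -/
noncomputable def conjAction (x : Fin n → G) :
    Multiplicative (Fin n → ℤ) →* Module.End ℤ (Additive (commutator G)) where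
  toFun α := (MonoidHom.toAdditive
    (MulAut.conjNormal (orderedPower x α.toAdd)⁻¹ : MulAut (commutator G)).toMonoidHom
    ).toIntLinearMap
  map_one' := by
    ext u
    simp [orderedPower]
  map_mul' α β := by
    have h : (MulAut.conjNormal (orderedPower x (α * β).toAdd)⁻¹ : MulAut (commutator G)) =
        MulAut.conjNormal (orderedPower x α.toAdd)⁻¹ *
          MulAut.conjNormal (orderedPower x β.toAdd)⁻¹ := by
      rw [← map_mul]
      refine conjNormal_eq_of_abelianization_eq ?_
      have := map_mul (orderedPowerHom x) α β
      change Abelianization.of _ = Abelianization.of _ * Abelianization.of _ at this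
      rw [map_inv, this, map_mul, map_inv, map_inv, mul_inv]
    rw [h]
    rfl

/-- The commutator subgroup as a module over the Laurent polynomials. -/
@[reducible] noncomputable def commutatorModule (x : Fin n → G) :
    Module (Laurent n) (Additive (commutator G)) :=
  Module.compHom _ (AddMonoidAlgebra.lift ℤ _ _ (conjAction x)).toRingHom

theorem commutatorModule_smul (x : Fin n → G) (Q : Laurent n) (u : commutator G) :
    letI := commutatorModule x
    Q • Additive.ofMul u = Additive.ofMul (laurentPower x u Q) := by
  change AddMonoidAlgebra.lift ℤ _ _ (conjAction x) Q _ = _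
  rw [AddMonoidAlgebra.lift_apply, laurentPower, Finsupp.sum, Finsupp.prod, LinearMap.sum_apply,
    ofMul_prod]
  rfl

theorem gen_smul (x : Fin n → G) (i : Fin n) (u : commutator G) :
    letI := commutatorModule x
    gen i • Additive.ofMul u = Additive.ofMul (MulAut.conjNormal (x i)⁻¹ u) := by
  rw [commutatorModule_smul, laurentPower, gen, mono, AddMonoidAlgebra.coeff_single,
    Finsupp.prod_single_index (zpow_zero _), zpow_one,
    conjNormal_eq_of_abelianization_eq (h := (x i)⁻¹)]
  rw [map_inv, map_inv, map_orderedPower, Finset.prod_eq_single i] <;> simp +contextual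

theorem commutator_jacobi (x : Fin n → G) (i j k : Fin n) :
    letI := commutatorModule x
    (gen k - 1 : Laurent n) • Additive.ofMul (rightCommutator (x i) (x j)) =
      (gen i - 1 : Laurent n) • Additive.ofMul (rightCommutator (x k) (x j)) -
        (gen j - 1 : Laurent n) • Additive.ofMul (rightCommutator (x k) (x i)) := by
  let := commutatorModule x
  -- A Hall–Witt type identity valid in every group; the order of the factors matters for `group`.
  -- Written additively in G', it is the claim.
  have h : MulAut.conjNormal (x k)⁻¹ (rightCommutator (x i) (x j)) * rightCommutator (x k) (x j) *
      MulAut.conjNormal (x j)⁻¹ (rightCommutator (x k) (x i)) =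
      rightCommutator (x k) (x i) * MulAut.conjNormal (x i)⁻¹ (rightCommutator (x k) (x j)) *
        rightCommutator (x i) (x j) := by
    ext
    simp only [rightCommutator, Subgroup.coe_mul, MulAut.conjNormal_apply]
    group
  have h' := congrArg Additive.ofMul h
  simp only [ofMul_mul, ← gen_smul] at h'
  simp only [sub_smul, one_smul]
  rw [sub_eq_sub_iff_add_eq_add, ← sub_eq_zero] 
  rw [← sub_eq_zero] at h'
  rw [← h']
  abel

/-- Let K be the subgroup of G' formed by the restricted combinations. It is normal and the
generators commute modulo K, so G' ≤ K. It remains to split off an ordered power with the same image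
as g in the abelianization. -/
theorem exists_normalForm {x : Fin n → G} (hx : Function.Surjective (FreeGroup.lift x)) (g : G) :
    ∃ γ β, IsRestricted β ∧ g = normalForm x γ β := by
  let := commutatorModule x
  let A := restrictedSpan fun i j => Additive.ofMul (rightCommutator (x i) (x j))
  have hA : ∀ (Q : Laurent n) (u : Additive (commutator G)), u ∈ A → Q • u ∈ A :=
    fun Q u hu => smul_mem_restrictedSpan (commutator_jacobi x) Q hu
  let K : Subgroup G := (AddSubgroup.toSubgroup' A).map (commutator G).subtype
  have hK : ∀ u : commutator G, (u : G) ∈ K ↔ Additive.ofMul u ∈ A := fun u =>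
    ⟨fun ⟨v, hv, h⟩ => by rwa [← Subtype.ext h], fun hu => ⟨u, hu, rfl⟩⟩
  -- Conjugation on G' depends only on the class in the abelianization, where every element is an
  -- ordered power; so it acts as a monomial, and `A` is stable under monomials.
  have hN : K.Normal := by
    refine ⟨?_⟩
    rintro _ ⟨u, hu, rfl⟩ g
    obtain ⟨γ, hγ⟩ := exists_orderedPower hx g⁻¹
    have e : g * u * g⁻¹ = (MulAut.conjNormal (orderedPower x γ)⁻¹ u : commutator G) := by
      rw [← conjNormal_eq_of_abelianization_eq (g := g) (by rw [map_inv, ← hγ, map_inv, inv_inv])]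
      rfl
    refine (congrArg (· ∈ K) e).mpr ((hK _).2 ?_)
    have := hA (mono γ) _ hu
    rw [← ofMul_toMul u, commutatorModule_smul, laurentPower, mono, AddMonoidAlgebra.coeff_single,
      Finsupp.prod_single_index (zpow_zero _), zpow_one] at this
    exact this
  have hcomm : ∀ i j, (QuotientGroup.mk (x i) : G ⧸ K) * QuotientGroup.mk (x j) =
      QuotientGroup.mk (x j) * QuotientGroup.mk (x i) := by
    have key : ∀ i j, j < i → (QuotientGroup.mk (x j) : G ⧸ K) * QuotientGroup.mk (x i) =
        QuotientGroup.mk (x i) * QuotientGroup.mk (x j) := fun i j hij => by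
      rw [← QuotientGroup.mk_mul, ← QuotientGroup.mk_mul, QuotientGroup.eq]
      have h1 : (x j * x i)⁻¹ * (x i * x j) = (rightCommutator (x i) (x j) : commutator G) := by
        simp [rightCommutator, mul_assoc]
      rw [h1, hK]
      simpa using smul_mem_restrictedSpan_of_mem
        (fun i j => Additive.ofMul (rightCommutator (x i) (x j))) ⟨(i, j), hij⟩ (one_mem _)
    intro i j
    rcases lt_trichotomy i j with h | rfl | h
    · exact key j i h
    · rfl
    · exact (key i j h).symm
  have hle : commutator G ≤ K := by
    rw [← hN.quotient_commutative_iff_commutator_le]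
    have h1 : ∀ (i : Fin n) (w : FreeGroup (Fin n)),
        Commute (QuotientGroup.mk (x i) : G ⧸ K) (QuotientGroup.mk (FreeGroup.lift x w)) := by
      intro i w
      induction w using FreeGroup.induction_on with
      | C1 => simp
      | of j => simpa using show Commute _ _ from hcomm i j
      | inv_of j h => simpa using h.inv_right
      | mul v w hv hw => simpa using hv.mul_right hw
    have h2 : ∀ (v w : FreeGroup (Fin n)), Commute (QuotientGroup.mk (FreeGroup.lift x w) : G ⧸ K)
        (QuotientGroup.mk (FreeGroup.lift x v)) := by
      intro v w
      induction w using FreeGroup.induction_on with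
      | C1 => simp
      | of j => simpa using h1 j v
      | inv_of j h => simpa using h.inv_left
      | mul v w hv hw => simpa using hv.mul_left hw
    refine ⟨⟨fun a b => ?_⟩⟩
    obtain ⟨a, rfl⟩ := QuotientGroup.mk_surjective a
    obtain ⟨b, rfl⟩ := QuotientGroup.mk_surjective b
    obtain ⟨v, rfl⟩ := hx a
    obtain ⟨w, rfl⟩ := hx b
    exact h2 w v
  obtain ⟨γ, hγ⟩ := exists_orderedPower hx g
  have hu : (orderedPower x γ)⁻¹ * g ∈ commutator G := QuotientGroup.eq.1 hγ.symm
  obtain ⟨β, hβ, h⟩ := (hK ⟨_, hu⟩).1 (hle hu)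
  refine ⟨γ, β, hβ, ?_⟩
  simp only [commutatorModule_smul, ← ofMul_prod] at h
  have h' := congrArg Subtype.val (Additive.ofMul.injective h)
  rw [normalForm, ← h']
  simp

end Existence

/-! ### Multiplication in terms of normal forms -/

section Multiplication

variable {n : ℕ}

/-- The product of `aᵢ - 1` and the `i`-th entry of the Magnus vector of a normal form. -/
noncomputable def scaledVec (γ : Fin n → ℤ) (β : LowerPair n → Laurent n) (i : Fin n) : Laurent n :=
  mono (fun k => if i ≤ k then γ k else 0) - mono (fun k => if i < k then γ k else 0) +
    (∑ p, β p * koszul p i) * (gen i - 1)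

variable {G : Type u} [Group G] [IsMetabelian G] {x : Fin n → G}

/-- An element of the kernel has a normal form; its degree gives γ = 0, and then independence of the
Koszul vectors gives β = 0. -/
theorem magnusMap_injective (hx : IsFreeMetabelianBasis x) :
    Function.Injective (magnusMap hx) := by
  have h0 : ∀ γ β, IsRestricted β → magnusMap hx (normalForm x γ β) = 1 → γ = 0 ∧ β = 0 := by
    intro γ β hβ h
    obtain ⟨h1, h2⟩ := magnusMap_normalForm hx γ β
    have hγ : γ = 0 := by rw [← h1, h]; rfl
    refine ⟨hγ, eq_zero_of_sum_koszul_eq_zero hβ ?_⟩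
    subst hγ
    have h3 : orderedPower x 0 = 1 := by simp [orderedPower]
    rw [h, h3, map_one, MagnusGroup.one_vec, zero_add] at h2
    exact h2.symm
  rw [injective_iff_map_eq_one]
  intro g hg
  obtain ⟨γ, β, hβ, rfl⟩ := exists_normalForm hx.1 g
  obtain ⟨rfl, rfl⟩ := h0 γ β hβ hg
  simp [normalForm, orderedPower, laurentPower]

theorem normalForm_inj (hx : IsFreeMetabelianBasis x) {γ γ' : Fin n → ℤ}
    {β β' : LowerPair n → Laurent n} (hβ : IsRestricted β) (hβ' : IsRestricted β')
    (h : normalForm x γ β = normalForm x γ' β') : γ = γ' ∧ β = β' :=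
  normalForm_injective hx hβ hβ' (congrArg _ h)

/-- The factor aᵢ - 1 clears the denominator in the vector of an ordered power, so that `scaledVec`
is built from monomials by ring operations. -/
theorem magnusMap_normalForm_vec (hx : IsFreeMetabelianBasis x) (γ : Fin n → ℤ)
    (β : LowerPair n → Laurent n) (i : Fin n) :
    (magnusMap hx (normalForm x γ β)).vec i * (gen i - 1) = scaledVec γ β i := by
  rw [(magnusMap_normalForm hx γ β).2, Pi.add_apply, add_mul, (magnusMap_orderedPower hx γ).2,
    scaledVec, Finset.sum_apply]
  rfl

/-- The multiplication table of normal forms. -/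
def NormalFormMul (γ₁ : Fin n → ℤ) (β₁ : LowerPair n → Laurent n) (γ₂ : Fin n → ℤ)
    (β₂ : LowerPair n → Laurent n) (γ₃ : Fin n → ℤ) (β₃ : LowerPair n → Laurent n) : Prop :=
  mono γ₁ * mono γ₂ = mono γ₃ ∧
    ∀ i, mono γ₂ * scaledVec γ₁ β₁ i + scaledVec γ₂ β₂ i = scaledVec γ₃ β₃ i

/-- The left side mentions neither `G` nor `x`, which is the source of all uniformity in the basis.
Addition of degrees is phrased through monomials so that every condition is an equation in the
Laurent ring, and aᵢ - 1 is cancelled because the ring is a domain. -/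
theorem normalFormMul_iff (hx : IsFreeMetabelianBasis x) (γ₁ γ₂ γ₃ : Fin n → ℤ)
    (β₁ β₂ β₃ : LowerPair n → Laurent n) :
    NormalFormMul γ₁ β₁ γ₂ β₂ γ₃ β₃ ↔
      normalForm x γ₁ β₁ * normalForm x γ₂ β₂ = normalForm x γ₃ β₃ := by
  rw [← (magnusMap_injective hx).eq_iff, map_mul, MagnusGroup.ext_iff, MagnusGroup.mul_deg,
    MagnusGroup.mul_vec, (magnusMap_normalForm hx _ _).1, (magnusMap_normalForm hx _ _).1,
    (magnusMap_normalForm hx _ _).1, NormalFormMul, ← mono_add, mono_injective.eq_iff]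
  refine and_congr_right fun _ => Iff.trans (forall_congr' fun i => ?_) funext_iff.symm
  conv_rhs => rw [← (mul_left_injective₀ (gen_sub_one_ne_zero i)).eq_iff]
  simp only [Pi.add_apply, Pi.smul_apply, smul_eq_mul, add_mul, mul_assoc,
    magnusMap_normalForm_vec]

end Multiplication

/-! ### Computability -/

section Computability

variable {α β σ : Type*} [Primcodable α] [Primcodable β] [Primcodable σ]

theorem Computable.fin_pi {m : ℕ} {f : α → Fin m → σ} (hf : ∀ i, Computable fun a => f a i) :
    Computable f :=
  (Primrec.vector_get'.to_comp.comp (Computable.vector_ofFn hf)).of_eq fun a => by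
    ext i; simp

theorem Computable.coordTuple {n : ℕ} (c : CoordIdx n) :
    Computable fun u : CoordIdx n → ℤ => u c := by
  have h := Computable.fin_app.comp (Primrec.of_equiv (e := Equiv.arrowCongr
    (Fintype.equivFin (CoordIdx n)) (Equiv.refl ℤ))).to_comp
    (Computable.const (Fintype.equivFin (CoordIdx n) c))
  exact h.of_eq fun u => by simp

theorem Computable.coordTuple_mk {n : ℕ} {f : α → CoordIdx n → ℤ}
    (hf : ∀ c, Computable fun a => f a c) : Computable f := by
  have h := (Primrec.of_equiv_symm (e := Equiv.arrowCongr
    (Fintype.equivFin (CoordIdx n)) (Equiv.refl ℤ))).to_comp.comp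
    (Computable.fin_pi (f := fun a i => f a ((Fintype.equivFin (CoordIdx n)).symm i))
      fun i => hf _)
  exact h.of_eq fun a => by ext; simp

/-- Unbounded search. -/
theorem exists_partrec_search {c : α → β → Bool} (hc : Computable₂ c) {g : β → σ}
    (hg : Computable g) : ∃ M : α →. σ, Partrec M ∧
      (∀ a, ∀ r ∈ M a, ∃ b, c a b = true ∧ r = g b) ∧
        ∀ a b, c a b = true → ∃ r, r ∈ M a := by
  refine ⟨fun a => Nat.rfindOpt fun k => (Encodable.decode (α := β) k).bind fun b =>
    cond (c a b) (some (g b)) none, Partrec.rfindOpt ?_, fun a r hr => ?_, fun a b hb => ?_⟩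
  · refine Computable.option_bind (Computable.decode.comp Computable.snd) ?_
    exact Computable.cond (hc.comp (Computable.fst.comp Computable.fst) Computable.snd)
      (Computable.option_some.comp (hg.comp Computable.snd)) (Computable.const none)
  · obtain ⟨k, hk⟩ := Nat.rfindOpt_spec hr
    simp only [Option.mem_def, Option.bind_eq_some_iff] at hk
    obtain ⟨b, -, hb⟩ := hk
    cases h : c a b
    · simp [h] at hb
    · simp only [h, cond_true, Option.some.injEq] at hb
      exact ⟨b, h, hb.symm⟩
  · exact Part.dom_iff_mem.1 (Nat.rfindOpt_dom.2
      ⟨Encodable.encode b, g b, by simp [hb]⟩)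

theorem REPred.exists_of_computable {c : α → β → Bool} (hc : Computable₂ c) :
    REPred fun a => ∃ b, c a b = true := by
  obtain ⟨M, hM, h1, h2⟩ := exists_partrec_search hc (Computable.const ())
  refine hM.dom_re.of_eq fun a => ?_
  rw [Part.dom_iff_mem]
  exact ⟨fun ⟨r, hr⟩ => (h1 a r hr).imp fun _ h => h.1, fun ⟨b, hb⟩ => h2 a b hb⟩

theorem REPred.comp {p : β → Prop} (hp : REPred p) {f : α → β} (hf : Computable f) :
    REPred fun a => p (f a) :=
  Partrec.comp hp hf

/-- The codes of the values of the function `F` are computable. -/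
def PolyComputable {n : ℕ} (ν : Laurent n → ℕ) (F : α → Laurent n) : Prop :=
  Computable fun a => ν (F a)

namespace PolyComputable

variable {n : ℕ} {ν : Laurent n → ℕ} {F F' : α → Laurent n}

theorem of_eq (h : PolyComputable ν F) (H : ∀ a, F a = F' a) : PolyComputable ν F' :=
  Computable.of_eq h fun a => by rw [H]

theorem const (P : Laurent n) : PolyComputable ν fun _ : α => P := Computable.const _

theorem comp {F : β → Laurent n} (h : PolyComputable ν F) {f : α → β} (hf : Computable f) :
    PolyComputable ν fun a => F (f a) :=
  Computable.comp (f := fun b => ν (F b)) h hf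

theorem cond {c : α → Bool} (hc : Computable c) (hF : PolyComputable ν F)
    (hF' : PolyComputable ν F') : PolyComputable ν fun a => cond (c a) (F a) (F' a) :=
  (Computable.cond hc hF hF').of_eq fun a => by
    dsimp only
    cases c a <;> rfl

variable (hν : IsComputableCoding ν)
include hν

theorem add (hF : PolyComputable ν F) (hF' : PolyComputable ν F') :
    PolyComputable ν fun a => F a + F' a := by
  obtain ⟨f, hf, h⟩ := hν.add
  exact (hf.comp hF hF').of_eq fun a => h _ _

theorem mul (hF : PolyComputable ν F) (hF' : PolyComputable ν F') :
    PolyComputable ν fun a => F a * F' a := by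
  obtain ⟨f, hf, h⟩ := hν.mul
  exact (hf.comp hF hF').of_eq fun a => h _ _

theorem sub (hF : PolyComputable ν F) (hF' : PolyComputable ν F') :
    PolyComputable ν fun a => F a - F' a :=
  (add hν hF (mul hν (const (-1)) hF')).of_eq fun a => by ring

theorem sum {ι : Type*} (s : Finset ι) {F : ι → α → Laurent n}
    (hF : ∀ i, PolyComputable ν (F i)) : PolyComputable ν fun a => ∑ i ∈ s, F i a := by
  classical
  induction s using Finset.induction_on with
  | empty => simpa using const 0
  | insert i s hi ih => simpa [Finset.sum_insert hi] using add hν (hF i) ih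

theorem prod {ι : Type*} (s : Finset ι) {F : ι → α → Laurent n}
    (hF : ∀ i, PolyComputable ν (F i)) : PolyComputable ν fun a => ∏ i ∈ s, F i a := by
  classical
  induction s using Finset.induction_on with
  | empty => simpa using const 1
  | insert i s hi ih => simpa [Finset.prod_insert hi] using mul hν (hF i) ih

theorem pow (P : Laurent n) {m : α → ℕ} (hm : Computable m) :
    PolyComputable ν fun a => P ^ m a := by
  obtain ⟨f, hf, h⟩ := hν.mul
  refine (Computable.nat_rec (f := m) (g := fun _ => ν 1) (h := fun _ p => f p.2 (ν P)) hm
    (Computable.const _) (hf.comp (Computable.snd.comp Computable.snd)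
      (Computable.const _)).to₂).of_eq fun a => ?_
  dsimp only
  induction m a with
  | zero => simp
  | succ k ih => rw [pow_succ, ← h, ← ih]

/-- The low bit of the code of an integer is its sign, so the monomial is a natural power of aᵢ or
of aᵢ⁻¹, two polynomials with fixed codes. -/
theorem mono_single (i : Fin n) : PolyComputable ν fun t : ℤ => mono (Pi.single i t) := by
  have h : PolyComputable ν fun k : ℕ => bif k.bodd then mono (Pi.single i (-1)) ^ (k.div2 + 1)
      else mono (Pi.single i 1) ^ k.div2 :=
    cond Computable.nat_bodd (pow hν _ (Computable.succ.comp Computable.nat_div2))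
      (pow hν _ Computable.nat_div2)
  have hp : ∀ (z : ℤ) (k : ℕ),
      mono (Pi.single i z : Fin n → ℤ) ^ k = mono (Pi.single i (k * z)) := by
    intro z k
    induction k with
    | zero => simp [mono_zero]
    | succ k ih => rw [pow_succ, ih, ← mono_add, ← Pi.single_add]; congr; push_cast; ring
  refine (h.comp Computable.encode).of_eq fun t => ?_
  cases t with
  | ofNat m =>
    have : Encodable.encode (Int.ofNat m) = 2 * m := rfl
    rw [this, hp, hp]
    simp
  | negSucc m =>
    have : Encodable.encode (Int.negSucc m) = 2 * m + 1 := rfl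
    rw [this, hp, hp]
    simp [Int.negSucc_eq]

theorem monomial {γ : α → Fin n → ℤ} (hγ : ∀ i, Computable fun a => γ a i) :
    PolyComputable ν fun a => mono (γ a) := by
  refine (prod hν Finset.univ (F := fun i a => mono (Pi.single i (γ a i)))
    fun i => (mono_single hν i).comp (hγ i)).of_eq fun a => ?_
  have h : ∀ s : Finset (Fin n), ∏ i ∈ s, mono (Pi.single i (γ a i)) =
      mono (∑ i ∈ s, Pi.single i (γ a i)) := fun s => by
    classical
    induction s using Finset.induction_on with
    | empty => simp [mono_zero]
    | insert i s hi ih => rw [Finset.prod_insert hi, Finset.sum_insert hi, mono_add, ih]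
  rw [h, Finset.univ_sum_single]

end PolyComputable

end Computability

/-! ### Enumeration of the restricted Laurent polynomials. -/

section Enumeration

variable {n : ℕ}

/-- An enumeration of `ℤⁿ`. -/
def decodeExponent (n j : ℕ) : Fin n → ℤ :=
  (@Encodable.decode (Fin n → ℤ) Primcodable.toEncodable j).getD 0

theorem decodeExponent_encode (α : Fin n → ℤ) :
    decodeExponent n (@Encodable.encode (Fin n → ℤ) Primcodable.toEncodable α) = α := by
  simp [decodeExponent]

theorem computable_decodeExponent : Computable (decodeExponent n) :=
  Computable.option_getD Computable.decode (Computable.const 0)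

/-- The signed monomial in the first `m` variables with number `j`. -/
noncomputable def signedMono (n m j : ℕ) : Laurent n :=
  (bif j.bodd then 1 else -1) * mono fun i : Fin n =>
    if (i : ℕ) < m then decodeExponent n j.div2 i else 0

/-- An enumeration of the Laurent polynomials in the first `m` variables. -/
noncomputable def enumRestricted (n m : ℕ) : ℕ → Laurent n
  | 0 => 0
  | k + 1 => signedMono n m k.unpair.1 + enumRestricted n m k.unpair.2
decreasing_by exact Nat.lt_succ_of_le (Nat.unpair_right_le k)

theorem signedMono_mem (m j : ℕ) : signedMono n m j ∈ restricted n m := by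
  refine mul_mem ?_ (mono_mem_restricted.2 fun k hk => if_neg (not_lt.2 hk))
  cases j.bodd
  · exact neg_mem (one_mem _)
  · exact one_mem _

theorem enumRestricted_mem (m k : ℕ) : enumRestricted n m k ∈ restricted n m := by
  induction k using Nat.strong_induction_on with
  | _ k ih =>
    cases k with
    | zero => rw [enumRestricted]; exact zero_mem _
    | succ k =>
      rw [enumRestricted]
      exact add_mem (signedMono_mem _ _) (ih _ (Nat.lt_succ_of_le (Nat.unpair_right_le k)))

theorem exists_enumRestricted {m : ℕ} {Q : Laurent n} (hQ : Q ∈ restricted n m) :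
    ∃ k, enumRestricted n m k = Q := by
  -- Stability of the range under adding Q or -Q is the form of the claim that passes through sums
  -- and negation, since the enumeration only adds one signed monomial at a time.
  have key : ∀ P ∈ Set.range (enumRestricted n m), Q + P ∈ Set.range (enumRestricted n m) ∧
      -Q + P ∈ Set.range (enumRestricted n m) := by
    refine restricted_induction (p := fun Q => ∀ P ∈ Set.range (enumRestricted n m),
      Q + P ∈ Set.range (enumRestricted n m) ∧ -Q + P ∈ Set.range (enumRestricted n m))
      ?_ ?_ ?_ ?_ hQ
    · intro P hP
      simpa using hP
    · intro P Q hP hQ R hR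
      rw [add_assoc, neg_add, add_assoc]
      exact ⟨(hP _ (hQ R hR).1).1, (hP _ (hQ R hR).2).2⟩
    · intro P hP R hR
      rw [neg_neg]
      exact (hP R hR).symm
    · rintro α hα _ ⟨k, rfl⟩
      have hα' : (fun i : Fin n => if (i : ℕ) < m then α i else 0) = α := by
        ext i
        split_ifs with h
        · rfl
        · exact (hα i (not_lt.1 h)).symm
      -- The low bit is the sign: odd for +, even for -. The final + 1 steps past the index 0 of the
      -- zero polynomial.
      refine ⟨⟨Nat.pair (2 * @Encodable.encode _ Primcodable.toEncodable α + 1) k + 1, ?_⟩,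
        ⟨Nat.pair (2 * @Encodable.encode _ Primcodable.toEncodable α) k + 1, ?_⟩⟩
      · rw [enumRestricted, Nat.unpair_pair, signedMono]
        simp [decodeExponent_encode, hα']
      · rw [enumRestricted, Nat.unpair_pair, signedMono]
        simp [decodeExponent_encode, hα']
  obtain ⟨k, hk⟩ := (key 0 ⟨0, by rw [enumRestricted]⟩).1
  exact ⟨k, by rw [hk, add_zero]⟩

variable {ν : Laurent n → ℕ} (hν : IsComputableCoding ν)
include hν

theorem polyComputable_signedMono (m : ℕ) : PolyComputable ν (signedMono n m) := by
  refine .mul hν (.cond Computable.nat_bodd (.const _) (.const _)) (.monomial hν fun i => ?_)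
  by_cases h : (i : ℕ) < m
  · simp only [h, if_true]
    exact Computable.fin_app.comp (computable_decodeExponent.comp Computable.nat_div2)
      (Computable.const i)
  · simp only [h, if_false]
    exact Computable.const 0

theorem polyComputable_enumRestricted (m : ℕ) : PolyComputable ν (enumRestricted n m) := by
  obtain ⟨f, hf, h⟩ := hν.add
  -- Course-of-values recursion: `L` lists the earlier values, so its length is the current
  -- argument.
  have hg : Computable₂ fun (_ : Unit) (L : List ℕ) => Nat.casesOn (motive := fun _ => Option ℕ)
      L.length (some (ν 0)) fun k =>
        (L[k.unpair.2]?).map fun c => f (ν (signedMono n m k.unpair.1)) c := by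
    refine Computable.nat_casesOn (Computable.list_length.comp Computable.snd)
      (Computable.const _) (Computable.option_map ?_ ?_)
    · exact Computable.list_getElem?.comp (Computable.snd.comp Computable.fst)
        (Computable.snd.comp (Computable.unpair.comp Computable.snd))
    · exact hf.comp ((polyComputable_signedMono hν m).comp (Computable.fst.comp
        (Computable.unpair.comp (Computable.snd.comp Computable.fst)))) Computable.snd
  have := Computable.nat_strong_rec (fun (_ : Unit) k => ν (enumRestricted n m k)) hg fun _ k => by
    cases k with
    | zero => simp [enumRestricted]
    | succ k =>
      have : k.unpair.2 < k + 1 := Nat.lt_succ_of_le (Nat.unpair_right_le k)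
      simp [this, h, enumRestricted]
  exact this.comp (Computable.const ()) Computable.id

end Enumeration

/-! ### Coordinate tuples -/

section Coordinates

variable {n : ℕ}

/-- The exponents encoded in a tuple. -/
def repExp (u : CoordIdx n → ℤ) : Fin n → ℤ := fun i => u (Sum.inl i)

/-- The Laurent polynomials encoded in a tuple. -/
noncomputable def repPoly (u : CoordIdx n → ℤ) (p : LowerPair n) : Laurent n :=
  enumRestricted n (p.1.1 + 1) (Encodable.encode (u (Sum.inr p)))

/-- The coordinate tuple encoded in a tuple. -/
noncomputable def repCoord (ν : Laurent n → ℕ) (u : CoordIdx n → ℤ) : CoordIdx n → ℤ :=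
  Sum.elim (repExp u) fun p => (ν (repPoly u p) : ℤ)

theorem isRestricted_repPoly (u : CoordIdx n → ℤ) : IsRestricted (repPoly u) :=
  isRestricted_iff.2 fun _ => enumRestricted_mem _ _

theorem exists_rep (γ : Fin n → ℤ) {β : LowerPair n → Laurent n} (hβ : IsRestricted β) :
    ∃ u, repExp u = γ ∧ repPoly u = β := by
  choose k hk using fun p => exists_enumRestricted (isRestricted_iff.1 hβ p)
  refine ⟨Sum.elim γ fun p => Denumerable.ofNat ℤ (k p), rfl, funext fun p => ?_⟩
  rw [← hk p, repPoly, Sum.elim_inr]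
  exact congrArg _ (Denumerable.encode_ofNat _)

/-- The multiplication table in terms of encoding tuples. -/
def RepMul (u v w : CoordIdx n → ℤ) : Prop :=
  NormalFormMul (repExp u) (repPoly u) (repExp v) (repPoly v) (repExp w) (repPoly w)

/-- The multiplication table in terms of coordinate tuples. -/
def CoordMul (ν : Laurent n → ℕ) (s t r : CoordIdx n → ℤ) : Prop :=
  ∃ u v w, RepMul u v w ∧ repCoord ν u = s ∧ repCoord ν v = t ∧ repCoord ν w = r

section Group

variable {G : Type u} [Group G] [IsMetabelian G] {x : Fin n → G} {ν : Laurent n → ℕ}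
  {s t r : CoordIdx n → ℤ} {g h k : G}

theorem isCoordinateTuple_iff :
    IsCoordinateTuple ν x s g ↔ ∃ u, g = normalForm x (repExp u) (repPoly u) ∧ repCoord ν u = s := by
  constructor
  · rintro ⟨γ, β, hβ, hg, hs⟩
    obtain ⟨u, rfl, rfl⟩ := exists_rep γ hβ
    exact ⟨u, hg, hs.symm⟩
  · rintro ⟨u, hg, hs⟩
    exact ⟨_, _, isRestricted_repPoly u, hg, hs.symm⟩

theorem exists_isCoordinateTuple_left (ν : Laurent n → ℕ) (x : Fin n → G) (s : CoordIdx n → ℤ) :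
    (∃ g, IsCoordinateTuple ν x s g) ↔ ∃ u, repCoord ν u = s := by
  simp [isCoordinateTuple_iff]

theorem exists_isCoordinateTuple_right (ν : Laurent n → ℕ) (hx : IsFreeMetabelianBasis x) (g : G) :
    ∃ s, IsCoordinateTuple ν x s g := by
  obtain ⟨γ, β, hβ, hg⟩ := exists_normalForm hx.1 g
  exact ⟨_, γ, β, hβ, hg, rfl⟩

theorem IsCoordinateTuple.elem_unique (hν : Function.Injective ν) (hg : IsCoordinateTuple ν x s g)
    (hh : IsCoordinateTuple ν x s h) : g = h := by
  obtain ⟨γ, β, -, rfl, rfl⟩ := hg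
  obtain ⟨γ', β', -, rfl, hs⟩ := hh
  obtain rfl : γ = γ' := funext fun i => congrFun hs (Sum.inl i)
  obtain rfl : β = β' := funext fun p => hν (Int.ofNat_inj.1 (congrFun hs (Sum.inr p)))
  rfl

theorem IsCoordinateTuple.tuple_unique (hx : IsFreeMetabelianBasis x)
    (hs : IsCoordinateTuple ν x s g) (ht : IsCoordinateTuple ν x t g) : s = t := by
  obtain ⟨γ, β, hβ, rfl, rfl⟩ := hs
  obtain ⟨γ', β', hβ', h, rfl⟩ := ht
  obtain ⟨rfl, rfl⟩ := normalForm_inj hx hβ hβ' h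
  rfl

/-- Injectivity of ν makes a tuple determine its element, so the choice of the encoding tuples u, v,
w is immaterial. -/
theorem coordMul_iff (hν : Function.Injective ν) (hx : IsFreeMetabelianBasis x)
    (hs : IsCoordinateTuple ν x s g) (ht : IsCoordinateTuple ν x t h)
    (hr : IsCoordinateTuple ν x r k) : CoordMul ν s t r ↔ g * h = k := by
  constructor
  · rintro ⟨u, v, w, hm, hu, hv, hw⟩
    rw [hs.elem_unique hν (isCoordinateTuple_iff.2 ⟨u, rfl, hu⟩),
      ht.elem_unique hν (isCoordinateTuple_iff.2 ⟨v, rfl, hv⟩),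
      hr.elem_unique hν (isCoordinateTuple_iff.2 ⟨w, rfl, hw⟩)]
    exact (normalFormMul_iff hx _ _ _ _ _ _).1 hm
  · intro hm
    obtain ⟨u, rfl, hu⟩ := isCoordinateTuple_iff.1 hs
    obtain ⟨v, rfl, hv⟩ := isCoordinateTuple_iff.1 ht
    obtain ⟨w, rfl, hw⟩ := isCoordinateTuple_iff.1 hr
    exact ⟨u, v, w, (normalFormMul_iff hx _ _ _ _ _ _).2 hm, hu, hv, hw⟩

end Group

section Computability

variable {ν : Laurent n → ℕ} (hν : IsComputableCoding ν)
include hν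

theorem polyComputable_repPoly (p : LowerPair n) : PolyComputable ν fun u => repPoly u p :=
  (polyComputable_enumRestricted hν _).comp (Computable.encode.comp (Computable.coordTuple _))

theorem computable_repCoord : Computable (repCoord ν) := by
  refine Computable.coordTuple_mk fun c => ?_
  cases c with
  | inl i => exact Computable.coordTuple _
  | inr p =>
    -- The zigzag code of a natural number k, taken as an integer, is 2k.
    refine ((Primrec.ofNat ℤ).comp Primrec.nat_double).to_comp.comp (polyComputable_repPoly hν p)
      |>.of_eq fun u => ?_
    exact ((two_mul_natToInt_or _ _).2 (.inl (by simp [repCoord]))).symm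

theorem polyComputable_scaledVec (i : Fin n) :
    PolyComputable ν fun u : CoordIdx n → ℤ => scaledVec (repExp u) (repPoly u) i := by
  have hm : ∀ (q : Fin n → Prop) [DecidablePred q], PolyComputable ν fun u : CoordIdx n → ℤ =>
      mono fun k => if q k then repExp u k else 0 := fun q _ => by
    refine .monomial hν fun k => ?_
    by_cases h : q k
    · simp only [h, if_true]
      exact Computable.coordTuple (Sum.inl k)
    · simpa only [h, if_false] using Computable.const 0
  exact .add hν (.sub hν (hm _) (hm _)) (.mul hν (.sum hν _ fun p =>
    .mul hν (polyComputable_repPoly hν p) (.const _)) (.const _))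

/-- The n + 1 polynomial equations are compared at once as vectors of codes; ν being injective,
equal codes mean equal polynomials. -/
theorem exists_computable_repMul :
    ∃ c : (CoordIdx n → ℤ) × (CoordIdx n → ℤ) × (CoordIdx n → ℤ) → Bool,
    Computable c ∧ ∀ u v w, c (u, v, w) = true ↔ RepMul u v w := by
  let L : (CoordIdx n → ℤ) × (CoordIdx n → ℤ) × (CoordIdx n → ℤ) → Fin (n + 1) → Laurent n :=
    fun q => Fin.cons (mono (repExp q.1) * mono (repExp q.2.1)) fun i =>
      mono (repExp q.2.1) * scaledVec (repExp q.1) (repPoly q.1) i +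
        scaledVec (repExp q.2.1) (repPoly q.2.1) i
  let R : (CoordIdx n → ℤ) × (CoordIdx n → ℤ) × (CoordIdx n → ℤ) → Fin (n + 1) → Laurent n :=
    fun q => Fin.cons (mono (repExp q.2.2)) fun i => scaledVec (repExp q.2.2) (repPoly q.2.2) i
  have hmono : PolyComputable ν fun u : CoordIdx n → ℤ => mono (repExp u) :=
    .monomial hν fun i => Computable.coordTuple _
  have h2 : Computable fun q : (CoordIdx n → ℤ) × (CoordIdx n → ℤ) × (CoordIdx n → ℤ) => q.2.1 :=
    Computable.fst.comp Computable.snd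
  have h3 : Computable fun q : (CoordIdx n → ℤ) × (CoordIdx n → ℤ) × (CoordIdx n → ℤ) => q.2.2 :=
    Computable.snd.comp Computable.snd
  have hL : Computable fun q => fun i => ν (L q i) := by
    refine Computable.fin_pi fun i => ?_
    cases i using Fin.cases with
    | zero => exact PolyComputable.mul hν (hmono.comp Computable.fst) (hmono.comp h2)
    | succ i =>
      have hi := polyComputable_scaledVec hν i
      exact PolyComputable.add hν (.mul hν (hmono.comp h2) (hi.comp Computable.fst)) (hi.comp h2)
  have hR : Computable fun q => fun i => ν (R q i) := by
    refine Computable.fin_pi fun i => ?_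
    cases i using Fin.cases with
    | zero => exact hmono.comp h3
    | succ i => exact (polyComputable_scaledVec hν i).comp h3
  refine ⟨_, Primrec.eq.decide.to_comp.comp hL hR, fun u v w => ?_⟩
  simp only [decide_eq_true_eq, funext_iff, hν.injective.eq_iff, Fin.forall_fin_succ, L, R,
    Fin.cons_zero, Fin.cons_succ]
  rfl

/-- Search for encodings u, v of the two arguments and a w that completes the table, and output the
coordinates of w. The search need not halt when there is no solution. -/
theorem exists_partrec_coordMul : ∃ M : (CoordIdx n → ℤ) × (CoordIdx n → ℤ) →. (CoordIdx n → ℤ),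
    Partrec M ∧ ∀ s t, (∀ r ∈ M (s, t), CoordMul ν s t r) ∧
      ∀ r, CoordMul ν s t r → ∃ r, r ∈ M (s, t) := by
  obtain ⟨c, hc, h⟩ := exists_computable_repMul hν
  have heq := (Primrec.eq (α := CoordIdx n → ℤ)).decide.to_comp
  have hC := computable_repCoord hν
  have hc' : Computable₂ fun (a : (CoordIdx n → ℤ) × (CoordIdx n → ℤ))
      (b : (CoordIdx n → ℤ) × (CoordIdx n → ℤ) × (CoordIdx n → ℤ)) =>
      c b && (decide (repCoord ν b.1 = a.1) && decide (repCoord ν b.2.1 = a.2)) :=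
    Primrec.and.to_comp.comp (hc.comp Computable.snd) (Primrec.and.to_comp.comp
      (heq.comp (hC.comp (Computable.fst.comp Computable.snd))
        (Computable.fst.comp Computable.fst))
      (heq.comp (hC.comp (Computable.fst.comp (Computable.snd.comp Computable.snd)))
        (Computable.snd.comp Computable.fst)))
  obtain ⟨M, hM, h1, h2⟩ := exists_partrec_search hc'
    (hC.comp (Computable.snd.comp Computable.snd))
  refine ⟨M, hM, fun s t => ⟨fun r hr => ?_, ?_⟩⟩
  · obtain ⟨⟨u, v, w⟩, hb, rfl⟩ := h1 _ r hr
    simp only [Bool.and_eq_true, decide_eq_true_eq, h] at hb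
    exact ⟨u, v, w, hb.1, hb.2.1, hb.2.2, rfl⟩
  · rintro r ⟨u, v, w, hm, hu, hv, hw⟩
    refine h2 _ (u, v, w) ?_
    simp only [Bool.and_eq_true, decide_eq_true_eq, h]
    exact ⟨hm, hu, hv⟩

/-- With `e` the tuple of the identity this is inversion: the same search with the product
prescribed and the second factor as output. -/
theorem exists_partrec_coordMul_eq (e : CoordIdx n → ℤ) :
    ∃ I : (CoordIdx n → ℤ) →. (CoordIdx n → ℤ),
    Partrec I ∧ ∀ s, (∀ r ∈ I s, CoordMul ν s r e) ∧
      ∀ r, CoordMul ν s r e → ∃ r, r ∈ I s := by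
  obtain ⟨c, hc, h⟩ := exists_computable_repMul hν
  have heq := (Primrec.eq (α := CoordIdx n → ℤ)).decide.to_comp
  have hC := computable_repCoord hν
  have hc' : Computable₂ fun (a : CoordIdx n → ℤ)
      (b : (CoordIdx n → ℤ) × (CoordIdx n → ℤ) × (CoordIdx n → ℤ)) =>
      c b && (decide (repCoord ν b.1 = a) && decide (repCoord ν b.2.2 = e)) :=
    Primrec.and.to_comp.comp (hc.comp Computable.snd) (Primrec.and.to_comp.comp
      (heq.comp (hC.comp (Computable.fst.comp Computable.snd)) Computable.fst)
      (heq.comp (hC.comp (Computable.snd.comp (Computable.snd.comp Computable.snd)))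
        (Computable.const e)))
  obtain ⟨M, hM, h1, h2⟩ := exists_partrec_search hc'
    (hC.comp (Computable.fst.comp Computable.snd))
  refine ⟨M, hM, fun s => ⟨fun r hr => ?_, ?_⟩⟩
  · obtain ⟨⟨u, v, w⟩, hb, rfl⟩ := h1 _ r hr
    simp only [Bool.and_eq_true, decide_eq_true_eq, h] at hb
    exact ⟨u, v, w, hb.1, hb.2.1, rfl, hb.2.2⟩
  · rintro r ⟨u, v, w, hm, hu, hv, hw⟩
    refine h2 _ (u, v, w) ?_
    simp only [Bool.and_eq_true, decide_eq_true_eq, h]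
    exact ⟨hm, hu, hw⟩

theorem rePred_repCoord : REPred fun s : CoordIdx n → ℤ => ∃ u, repCoord ν u = s := by
  have hc : Computable₂ fun (s u : CoordIdx n → ℤ) => decide (repCoord ν u = s) :=
    (Primrec.eq (α := CoordIdx n → ℤ)).decide.to_comp.comp
      ((computable_repCoord hν).comp Computable.snd) Computable.fst
  exact (REPred.exists_of_computable hc).of_eq fun s => by simp

theorem rePred_coordMul : REPred fun q : (CoordIdx n → ℤ) × (CoordIdx n → ℤ) × (CoordIdx n → ℤ) =>
    CoordMul ν q.1 q.2.1 q.2.2 := by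
  obtain ⟨c, hc, h⟩ := exists_computable_repMul hν
  have hC := computable_repCoord hν
  have hc' : Computable₂ fun (a b : (CoordIdx n → ℤ) × (CoordIdx n → ℤ) × (CoordIdx n → ℤ)) =>
      c b && decide ((repCoord ν b.1, repCoord ν b.2.1, repCoord ν b.2.2) = a) :=
    Primrec.and.to_comp.comp (hc.comp Computable.snd)
      (Primrec.eq.decide.to_comp.comp
        (.pair (hC.comp (Computable.fst.comp Computable.snd))
          (.pair (hC.comp (Computable.fst.comp (Computable.snd.comp Computable.snd)))
            (hC.comp (Computable.snd.comp (Computable.snd.comp Computable.snd)))))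
        Computable.fst)
  refine (REPred.exists_of_computable hc').of_eq fun q => ?_
  obtain ⟨s, t, r⟩ := q
  simp only [Bool.and_eq_true, decide_eq_true_eq, Prod.exists, h, Prod.mk.injEq]
  rfl

end Computability

end Coordinates

/-! ### Definability of recursively enumerable relations between coordinate tuples. -/

section Definability

theorem IntDefinable.of_rePred_fintype {κ : Type} [Fintype κ] {P : (κ → ℤ) → Prop}
    (hP : REPred fun v : Fin (Fintype.card κ) → ℤ => P fun i => v (Fintype.equivFin κ i)) :
    IntDefinable P :=
  ((IntDefinable.of_rePred hP).comp (Fintype.equivFin κ).symm).of_iff fun v => by simp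

/-- The maps `a`, `b`, `c` place the variables of the three arguments and may coincide, which also
covers predicates of lower arity. -/
theorem IntDefinable.of_rePred_coordTuple {n : ℕ} {κ : Type} [Fintype κ]
    {P : (CoordIdx n → ℤ) × (CoordIdx n → ℤ) × (CoordIdx n → ℤ) → Prop} (hP : REPred P)
    (a b c : CoordIdx n → κ) :
    IntDefinable fun v : κ → ℤ => P (fun i => v (a i), fun i => v (b i), fun i => v (c i)) := by
  have h : ∀ d : CoordIdx n → κ, Computable fun v : Fin (Fintype.card κ) → ℤ =>
      fun i => v (Fintype.equivFin κ (d i)) := fun d =>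
    Computable.coordTuple_mk fun i => Computable.fin_app.comp .id (.const _)
  exact .of_rePred_fintype (hP.comp ((h a).pair ((h b).pair (h c))))

end Definability

/-! ### Existence of computable codings -/

section IntPrimrec

theorem Primrec.int_toNat : Primrec Int.toNat := by
  refine (Primrec.cond (Primrec.nat_bodd.comp Primrec.encode) (Primrec.const 0)
    (Primrec.nat_div2.comp Primrec.encode)).of_eq fun t => ?_
  cases t with
  | ofNat m =>
    have : Encodable.encode (Int.ofNat m) = 2 * m := rfl
    rw [this]; simp
  | negSucc m =>
    have : Encodable.encode (Int.negSucc m) = 2 * m + 1 := rfl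
    rw [this]; simp

/-- Splitting integers into positive and negative parts reduces addition to a difference of natural
numbers, whose zigzag code is explicit in either sign. -/
theorem Primrec.int_add : Primrec₂ ((· + ·) : ℤ → ℤ → ℤ) := by
  have hsub : Primrec₂ fun a b : ℕ => (a : ℤ) - b := by
    refine ((Primrec.ofNat ℤ).comp (Primrec.ite (Primrec.nat_le.comp Primrec.snd Primrec.fst)
      (Primrec.nat_double.comp (Primrec.nat_sub.comp Primrec.fst Primrec.snd))
      (Primrec.nat_double_succ.comp (Primrec.pred.comp
        (Primrec.nat_sub.comp Primrec.snd Primrec.fst))))).of_eq fun p => ?_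
    refine ((two_mul_natToInt_or _ _).2 ?_).symm
    have : Nat.pred (p.2 - p.1) = p.2 - p.1 - 1 := rfl
    rw [this]
    split_ifs with h <;> push_cast <;> omega
  have hneg : Primrec fun z : ℤ => (-z).toNat := by
    refine (Primrec.cond (Primrec.nat_bodd.comp Primrec.encode)
      (Primrec.succ.comp (Primrec.nat_div2.comp Primrec.encode)) (Primrec.const 0)).of_eq fun t => ?_
    cases t with
    | ofNat m =>
      have : Encodable.encode (Int.ofNat m) = 2 * m := rfl
      rw [this]; simp
    | negSucc m =>
      have : Encodable.encode (Int.negSucc m) = 2 * m + 1 := rfl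
      rw [this]; simp
  refine (hsub.comp
    (Primrec.nat_add.comp (Primrec.int_toNat.comp Primrec.fst) (Primrec.int_toNat.comp Primrec.snd))
    (Primrec.nat_add.comp (hneg.comp Primrec.fst) (hneg.comp Primrec.snd))).of_eq fun p => ?_
  push_cast
  omega

theorem Primrec.exponent_add (n : ℕ) :
    Primrec₂ ((· + ·) : (Fin n → ℤ) → (Fin n → ℤ) → Fin n → ℤ) :=
  Primrec.fin_curry.2 (Primrec.int_add.comp (Primrec.fin_app.comp (Primrec.fst.comp Primrec.fst)
    Primrec.snd) (Primrec.fin_app.comp (Primrec.snd.comp Primrec.fst) Primrec.snd))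

end IntPrimrec

section Coding

variable {n : ℕ}

/-- The sum of the monomials with exponents in a list. -/
noncomputable def monoSum (l : List (Fin n → ℤ)) : Laurent n := (l.map mono).sum

theorem monoSum_append (l l' : List (Fin n → ℤ)) : monoSum (l ++ l') = monoSum l + monoSum l' := by
  simp [monoSum]

theorem coeff_monoSum (l : List (Fin n → ℤ)) (α : Fin n → ℤ) :
    (monoSum l).coeff α = l.count α := by
  induction l with
  | nil => simp [monoSum]
  | cons β l ih =>
    have : monoSum (β :: l) = mono β + monoSum l := by simp [monoSum]
    rw [this, AddMonoidAlgebra.coeff_add, Finsupp.add_apply, ih, List.count_cons, mono,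
      AddMonoidAlgebra.coeff_single, Finsupp.single_apply]
    by_cases h : β = α <;> simp [h, add_comm]

/-- Coefficients are multiplicities; restricting the quantifier to the entries of the lists makes
equality primitive recursive. -/
theorem monoSum_eq_iff {l l' : List (Fin n → ℤ)} :
    monoSum l = monoSum l' ↔ ∀ α ∈ l ++ l', l.count α = l'.count α := by
  constructor
  · intro h α _
    have := coeff_monoSum l α
    rw [h, coeff_monoSum] at this
    exact_mod_cast this.symm
  · intro h
    refine AddMonoidAlgebra.coeff_injective (Finsupp.ext fun α => ?_)
    rw [coeff_monoSum, coeff_monoSum]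
    by_cases hα : α ∈ l ++ l'
    · rw [h α hα]
    · rw [List.mem_append, not_or] at hα
      rw [List.count_eq_zero_of_not_mem hα.1, List.count_eq_zero_of_not_mem hα.2]

/-- The sumset of two lists. -/
def sumList (l l' : List (Fin n → ℤ)) : List (Fin n → ℤ) :=
  l.flatMap fun α => l'.map fun β => α + β

theorem monoSum_sumList (l l' : List (Fin n → ℤ)) :
    monoSum (sumList l l') = monoSum l * monoSum l' := by
  have h1 : ∀ α, monoSum (l'.map fun β => α + β) = mono α * monoSum l' := fun α => by
    simp only [monoSum, List.map_map, ← List.sum_map_mul_left, Function.comp_def, mono_add]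
  induction l with
  | nil => simp [monoSum, sumList]
  | cons α l ih =>
    have : sumList (α :: l) l' = l'.map (fun β => α + β) ++ sumList l l' := by simp [sumList]
    rw [this, monoSum_append, h1, ih]
    simp [monoSum, add_mul]

theorem primrec_sumList : Primrec₂ (sumList (n := n)) :=
  Primrec.list_flatMap Primrec.fst (Primrec.list_map (Primrec.snd.comp Primrec.fst)
    ((Primrec.exponent_add n).comp (Primrec.snd.comp Primrec.fst) Primrec.snd))

/-- The Laurent polynomial denoted by a pair of lists of exponents. -/
noncomputable def diffSum (r : List (Fin n → ℤ) × List (Fin n → ℤ)) : Laurent n :=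
  monoSum r.1 - monoSum r.2

theorem diffSum_surjective : Function.Surjective (diffSum (n := n)) := by
  intro Q
  refine restricted_induction (p := fun Q => ∃ r, diffSum r = Q) ⟨([], []), by simp [diffSum]⟩
    ?_ ?_ ?_ (mem_restricted_self Q)
  · rintro _ _ ⟨r, rfl⟩ ⟨s, rfl⟩
    exact ⟨(r.1 ++ s.1, r.2 ++ s.2), by simp only [diffSum, monoSum_append]; ring⟩
  · rintro _ ⟨r, rfl⟩
    exact ⟨(r.2, r.1), by simp only [diffSum]; ring⟩
  · intro α _
    exact ⟨([α], []), by simp [diffSum, monoSum]⟩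

theorem primrecRel_diffSum_eq :
    PrimrecRel fun r s : List (Fin n → ℤ) × List (Fin n → ℤ) => diffSum r = diffSum s := by
  have hcount : Primrec₂ fun (α : Fin n → ℤ) (l : List (Fin n → ℤ)) => l.count α := by
    refine (Primrec.list_length.comp ((PrimrecRel.listFilter (Primrec.eq (α := Fin n → ℤ))).comp
      Primrec.snd Primrec.fst)).of_eq fun p => ?_
    dsimp only
    rw [List.count_eq_length_filter]
    congr 2
  have hrel : PrimrecRel fun (α : Fin n → ℤ) (p : List (Fin n → ℤ) × List (Fin n → ℤ)) =>
      p.1.count α = p.2.count α :=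
    Primrec.eq.comp (hcount.comp Primrec.fst (Primrec.fst.comp Primrec.snd))
      (hcount.comp Primrec.fst (Primrec.snd.comp Primrec.snd))
  have h1 : Primrec fun q : (List (Fin n → ℤ) × List (Fin n → ℤ)) ×
      (List (Fin n → ℤ) × List (Fin n → ℤ)) => q.1.1 ++ q.2.2 :=
    Primrec.list_append.comp (Primrec.fst.comp Primrec.fst) (Primrec.snd.comp Primrec.snd)
  have h2 : Primrec fun q : (List (Fin n → ℤ) × List (Fin n → ℤ)) ×
      (List (Fin n → ℤ) × List (Fin n → ℤ)) => q.2.1 ++ q.1.2 :=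
    Primrec.list_append.comp (Primrec.fst.comp Primrec.snd) (Primrec.snd.comp Primrec.fst)
  refine PrimrecPred.of_eq (hrel.forall_mem_list.comp (Primrec.list_append.comp h1 h2)
    (Primrec.pair h1 h2)) fun q => ?_
  dsimp only [diffSum]
  rw [sub_eq_sub_iff_add_eq_add, ← monoSum_append, ← monoSum_append,
    monoSum_eq_iff]

/-- Code a polynomial by the least index of a pair of lists denoting it. Equality of denotations is
decidable, so replacing an index by the least equivalent one is computable; the range consists of
the fixed points of this normalization, and operations are performed on lists and then normalized.
-/
theorem exists_isComputableCoding (n : ℕ) : ∃ ν : Laurent n → ℕ, IsComputableCoding ν := by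
  let D : ℕ → List (Fin n → ℤ) × List (Fin n → ℤ) := fun k =>
    (@Encodable.decode _ Primcodable.toEncodable k).getD ([], [])
  let N : List (Fin n → ℤ) × List (Fin n → ℤ) → ℕ := @Encodable.encode _ Primcodable.toEncodable
  have hDN : ∀ r, D (N r) = r := fun r => by
    simp only [D, N, Encodable.encodek, Option.getD_some]
  have hD : Primrec D := Primrec.option_getD.comp Primrec.decode (Primrec.const _)
  have hN : Primrec N := Primrec.encode
  have hsurj : ∀ P, ∃ k, diffSum (D k) = P := fun P => by
    obtain ⟨r, rfl⟩ := diffSum_surjective P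
    exact ⟨N r, by rw [hDN]⟩
  classical
  let ν : Laurent n → ℕ := fun P => Nat.find (hsurj P)
  have hν : ∀ P, diffSum (D (ν P)) = P := fun P => Nat.find_spec (hsurj P)
  have hnorm : Computable fun k => ν (diffSum (D k)) := by
    have h : PrimrecPred fun p : ℕ × ℕ => diffSum (D p.2) = diffSum (D p.1) :=
      primrecRel_diffSum_eq.comp (hD.comp Primrec.snd) (hD.comp Primrec.fst)
    exact Computable.find (P := fun k j => diffSum (D j) = diffSum (D k)) h.computablePred
      fun k => hsurj _
  refine ⟨ν, ⟨fun P Q h => by rw [← hν P, h, hν], ?_, ?_, ?_⟩⟩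
  · refine ComputablePred.of_eq (p := fun k => ν (diffSum (D k)) = k) ?_ fun k =>
      ⟨fun h => ⟨_, h⟩, ?_⟩
    · exact Computable.computablePred (Primrec.eq.decide.to_comp.comp hnorm Computable.id)
    · rintro ⟨P, rfl⟩
      rw [hν]
  · refine ⟨fun a b => ν (diffSum (D (N ((D a).1 ++ (D b).1, (D a).2 ++ (D b).2)))), ?_,
      fun P Q => ?_⟩
    · refine hnorm.comp (hN.comp (Primrec.pair ?_ ?_)).to_comp
      · exact Primrec.list_append.comp (Primrec.fst.comp (hD.comp Primrec.fst))
          (Primrec.fst.comp (hD.comp Primrec.snd))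
      · exact Primrec.list_append.comp (Primrec.snd.comp (hD.comp Primrec.fst))
          (Primrec.snd.comp (hD.comp Primrec.snd))
    · dsimp only
      rw [hDN]
      congr 1
      conv_rhs => rw [← hν P, ← hν Q]
      simp only [diffSum, monoSum_append]
      ring
  · refine ⟨fun a b => ν (diffSum (D (N (sumList (D a).1 (D b).1 ++ sumList (D a).2 (D b).2,
      sumList (D a).1 (D b).2 ++ sumList (D a).2 (D b).1)))), ?_, fun P Q => ?_⟩
    · have ha := hD.comp (Primrec.fst (α := ℕ) (β := ℕ))
      have hb := hD.comp (Primrec.snd (α := ℕ) (β := ℕ))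
      refine hnorm.comp (hN.comp (Primrec.pair ?_ ?_)).to_comp
      · exact Primrec.list_append.comp
          (primrec_sumList.comp (Primrec.fst.comp ha) (Primrec.fst.comp hb))
          (primrec_sumList.comp (Primrec.snd.comp ha) (Primrec.snd.comp hb))
      · exact Primrec.list_append.comp
          (primrec_sumList.comp (Primrec.fst.comp ha) (Primrec.snd.comp hb))
          (primrec_sumList.comp (Primrec.snd.comp ha) (Primrec.fst.comp hb))
    · dsimp only
      rw [hDN]
      congr 1
      conv_rhs => rw [← hν P, ← hν Q]
      simp only [diffSum, monoSum_append, monoSum_sumList]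
      ring

end Coding

/-! ### The interpretation -/

section Interpretation

open FirstOrder FirstOrder.Language Laurent

variable {n : ℕ}

/-- Assembling an interpretation code from definable relations. -/
theorem exists_interpretationCode {ν : Laurent n → ℕ} (hν : IsComputableCoding ν)
    (e : CoordIdx n → ℤ) :
    ∃ Γ : InterpretationCode groupLanguage Language.ring (CoordIdx n), Γ.IsInjective ℤ ∧
      (∀ s : CoordIdx n → ℤ, s ∈ Γ.Dom ℤ ↔ ∃ u, repCoord ν u = s) ∧
      (∀ v : (Fin 2 × CoordIdx n) ⊕ CoordIdx n → ℤ, (Γ.func GroupFunc.mul).Realize v ↔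
        CoordMul ν (fun i => v (Sum.inl (0, i))) (fun i => v (Sum.inl (1, i)))
          (fun i => v (Sum.inr i))) ∧
      (∀ v : (Fin 1 × CoordIdx n) ⊕ CoordIdx n → ℤ, (Γ.func GroupFunc.inv).Realize v ↔
        CoordMul ν (fun i => v (Sum.inl (0, i))) (fun i => v (Sum.inr i)) e) ∧
      (∀ v : (Fin 0 × CoordIdx n) ⊕ CoordIdx n → ℤ, (Γ.func GroupFunc.one).Realize v ↔
        (fun i => v (Sum.inr i)) = e) := by
  obtain ⟨dom, hdom⟩ : IntDefinable fun s : CoordIdx n → ℤ => ∃ u, repCoord ν u = s :=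
    .of_rePred_coordTuple (P := fun q => ∃ u, repCoord ν u = q.1)
      ((rePred_repCoord hν).comp Computable.fst) id id id
  obtain ⟨eqv, heqv⟩ : IntDefinable fun v : CoordIdx n ⊕ CoordIdx n → ℤ =>
      ∀ i, v (Sum.inl i) = v (Sum.inr i) :=
    .forall_index fun i => .eq (.var _) (.var _)
  obtain ⟨mul, hmul⟩ := IntDefinable.of_rePred_coordTuple (κ := (Fin 2 × CoordIdx n) ⊕ CoordIdx n)
    (rePred_coordMul hν) (fun i => Sum.inl (0, i)) (fun i => Sum.inl (1, i)) Sum.inr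
  obtain ⟨inv, hinv⟩ := IntDefinable.of_rePred_coordTuple (κ := (Fin 1 × CoordIdx n) ⊕ CoordIdx n)
    ((rePred_coordMul hν).comp (Computable.fst.pair
      ((Computable.fst.comp Computable.snd).pair (Computable.const e))))
    (fun i => Sum.inl (0, i)) Sum.inr Sum.inr
  obtain ⟨one, hone⟩ : IntDefinable fun v : (Fin 0 × CoordIdx n) ⊕ CoordIdx n → ℤ =>
      ∀ i, v (Sum.inr i) = e i :=
    .forall_index fun i => .eq (.var _) (.intCast _)
  refine ⟨⟨dom, eqv, fun {k} f => match k, f with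
    | _, GroupFunc.mul => mul
    | _, GroupFunc.inv => inv
    | _, GroupFunc.one => one, fun r => Empty.elim r⟩, fun s t => ?_, hdom, hmul, hinv,
      fun v => (hone v).trans funext_iff.symm⟩
  exact (heqv _).trans funext_iff.symm

/-- One tuple represents the identity relative to every basis, so it can be built into formulas and
algorithms that do not depend on `x`. -/
theorem exists_isCoordinateTuple_one {G : Type u} [Group G] [IsMetabelian G] (ν : Laurent n → ℕ) :
    ∃ u, ∀ x : Fin n → G, IsCoordinateTuple ν x (repCoord ν u) 1 := by
  obtain ⟨u, hu⟩ := exists_rep (0 : Fin n → ℤ) (β := 0)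
    (isRestricted_iff.2 fun _ => zero_mem _)
  refine ⟨u, fun x => isCoordinateTuple_iff.2 ⟨u, ?_, rfl⟩⟩
  rw [hu.1, hu.2]
  simp [normalForm, orderedPower, laurentPower]

theorem exists_uniform_interpretationCode {G : Type u} [Group G] [IsMetabelian G]
    {ν : Laurent n → ℕ} (hν : IsComputableCoding ν) :
    ∃ Γ : InterpretationCode groupLanguage Language.ring (CoordIdx n), Γ.IsInjective ℤ ∧
      ∀ x : Fin n → G, IsFreeMetabelianBasis x →
        Γ.Dom ℤ = {s | ∃ g, IsCoordinateTuple ν x s g} ∧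
        ∃ μ : Γ.Dom ℤ → G, Γ.IsCoordinateMap μ ∧
          ∀ s : Γ.Dom ℤ, IsCoordinateTuple ν x s (μ s) := by
  obtain ⟨u₀, hone⟩ := exists_isCoordinateTuple_one (G := G) ν
  obtain ⟨Γ, hinj, hdom, hmul, hinv, hone'⟩ := exists_interpretationCode hν (repCoord ν u₀)
  refine ⟨Γ, hinj, fun x hx => ?_⟩
  have hdom' : ∀ s, s ∈ Γ.Dom ℤ ↔ ∃ g, IsCoordinateTuple ν x s g := fun s => by
    rw [hdom, exists_isCoordinateTuple_left]
  choose μ hμ using fun s : Γ.Dom ℤ => (hdom' s).1 s.2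
  have hiff : ∀ s t : Γ.Dom ℤ, s = t ↔ μ s = μ t := fun s t =>
    ⟨fun h => by rw [h], fun h => Subtype.ext ((hμ s).tuple_unique hx (h ▸ hμ t))⟩
  refine ⟨Set.ext hdom', μ,
    ⟨fun g => ?_, fun s t => ?_, fun {k} f s t => ?_, fun r => Empty.elim r⟩, hμ⟩
  · obtain ⟨s, hs⟩ := exists_isCoordinateTuple_right ν hx g
    exact ⟨⟨s, (hdom' s).2 ⟨g, hs⟩⟩, (hμ _).elem_unique hν.injective hs⟩
  · rw [hinj, ← hiff, Subtype.ext_iff]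
  · cases f with
    | mul =>
      rw [hmul]
      exact coordMul_iff hν.injective hx (hμ (s 0)) (hμ (s 1)) (hμ t)
    | inv =>
      rw [hinv]
      refine (coordMul_iff hν.injective hx (hμ (s 0)) (hμ t) (hone x)).trans ?_
      rw [mul_eq_one_iff_eq_inv']
      exact eq_comm
    | one =>
      rw [hone']
      refine ⟨fun h => ?_, fun h => ?_⟩
      · exact (hone x).elem_unique hν.injective (by rw [← h]; exact hμ t)
      · exact (hμ t).tuple_unique hx (by rw [← show (1 : G) = μ t from h]; exact hone x)

/-- Reindexing the tuples of an interpretation. -/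
theorem absolutelyInjectivelyInterpretable_of_code {L L' : FirstOrder.Language.{0, 0}}
    {A : Type u} {B : Type v}
    [L.Structure A] [L'.Structure B] {ι : Type} [Fintype ι] (Γ : InterpretationCode L L' ι)
    (hΓ : Γ.IsInjective B) {μ : Γ.Dom B → A} (hμ : Γ.IsCoordinateMap μ) :
    AbsolutelyInjectivelyInterpretable L L' A B := by
  let e := Fintype.equivFin ι
  let Γ' : InterpretationCode L L' (Fin (Fintype.card ι)) :=
    { dom := Γ.dom.relabel e
      eqv := Γ.eqv.relabel (Sum.map e e)
      func := fun f => (Γ.func f).relabel (Sum.map (Prod.map id e) e)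
      rel := fun r => (Γ.rel r).relabel (Prod.map id e) }
  have hd : ∀ s, s ∈ Γ'.Dom B ↔ s ∘ e ∈ Γ.Dom B := fun s => Formula.realize_relabel
  refine ⟨_, Γ', fun s t => ?_, fun s => μ ⟨s ∘ e, (hd s).1 s.2⟩, fun a => ?_, fun s t => ?_,
    fun f s t => ?_, fun r s => ?_⟩
  · refine Formula.realize_relabel.trans ?_
    rw [Sum.elim_comp_map, hΓ]
    exact e.surjective.injective_comp_right.eq_iff
  · obtain ⟨s, rfl⟩ := hμ.surjective a
    have h1 : ((s : ι → B) ∘ e.symm) ∘ e = s := by ext; simp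
    exact ⟨⟨(s : ι → B) ∘ e.symm, (hd _).2 (by rw [h1]; exact s.2)⟩, congrArg μ (Subtype.ext h1)⟩
  · refine Formula.realize_relabel.trans ?_
    rw [Sum.elim_comp_map]
    exact hμ.eqv_iff ⟨_, (hd s).1 s.2⟩ ⟨_, (hd t).1 t.2⟩
  · refine Formula.realize_relabel.trans ?_
    rw [Sum.elim_comp_map]
    exact hμ.func_iff f (fun i => ⟨_, (hd (s i)).1 (s i).2⟩) ⟨_, (hd t).1 t.2⟩
  · exact Formula.realize_relabel.trans
      (hμ.rel_iff r fun i => ⟨_, (hd (s i)).1 (s i).2⟩)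

end Interpretation

end FreeMetabelian

theorem mainTheorem7 (n : ℕ) (hn : 2 ≤ n) (G : Type u) [Group G] [IsMetabelian G]
    (hG : IsFreeMetabelianOfRank n G) :
    -- `G` is absolutely and injectively interpretable in the ring of integers
    AbsolutelyInjectivelyInterpretable groupLanguage FirstOrder.Language.ring G ℤ ∧
    -- the Laurent polynomials have computable codings by natural numbers
    (∃ ν : Laurent n → ℕ, IsComputableCoding ν) ∧
    ∀ ν : Laurent n → ℕ, IsComputableCoding ν →
      -- on tuples of normal form coordinates, multiplication and inversion are computable
      (∃ M : (CoordIdx n → ℤ) × (CoordIdx n → ℤ) →. (CoordIdx n → ℤ), Partrec M ∧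
        ∀ x : Fin n → G, IsFreeMetabelianBasis x → ∀ s t g h,
          IsCoordinateTuple ν x s g → IsCoordinateTuple ν x t h →
            ∃ r ∈ M (s, t), IsCoordinateTuple ν x r (g * h)) ∧
      (∃ I : (CoordIdx n → ℤ) →. (CoordIdx n → ℤ), Partrec I ∧
        ∀ x : Fin n → G, IsFreeMetabelianBasis x → ∀ s g,
          IsCoordinateTuple ν x s g → ∃ r ∈ I s, IsCoordinateTuple ν x r g⁻¹) ∧
      -- a code whose domain is the set of tuples of normal form coordinates interprets `G`, and for
      -- every basis `x` the map from tuples to the elements with these coordinates relative to `x`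
      -- is a coordinate map
      ∃ Γ : InterpretationCode groupLanguage FirstOrder.Language.ring (CoordIdx n),
        Γ.IsInjective ℤ ∧
        ∀ x : Fin n → G, IsFreeMetabelianBasis x →
          Γ.Dom ℤ = {s | ∃ g, IsCoordinateTuple ν x s g} ∧
          ∃ μ : Γ.Dom ℤ → G, Γ.IsCoordinateMap μ ∧
            ∀ s : Γ.Dom ℤ, IsCoordinateTuple ν x s (μ s) := by
  have hcode : ∀ ν : Laurent n → ℕ, IsComputableCoding ν →
      ∃ Γ : InterpretationCode groupLanguage FirstOrder.Language.ring (CoordIdx n),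
        Γ.IsInjective ℤ ∧
        ∀ x : Fin n → G, IsFreeMetabelianBasis x →
          Γ.Dom ℤ = {s | ∃ g, IsCoordinateTuple ν x s g} ∧
          ∃ μ : Γ.Dom ℤ → G, Γ.IsCoordinateMap μ ∧
            ∀ s : Γ.Dom ℤ, IsCoordinateTuple ν x s (μ s) :=
    fun ν hν => exists_uniform_interpretationCode hν
  refine ⟨?_, exists_isComputableCoding n, fun ν hν => ⟨?_, ?_, hcode ν hν⟩⟩
  · obtain ⟨ν, hν⟩ := exists_isComputableCoding n
    obtain ⟨x, hx⟩ := hG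
    obtain ⟨Γ, hΓ, h⟩ := hcode ν hν
    obtain ⟨-, μ, hμ, -⟩ := h x hx
    exact absolutelyInjectivelyInterpretable_of_code Γ hΓ hμ
  · obtain ⟨M, hM, h⟩ := exists_partrec_coordMul hν
    refine ⟨M, hM, fun x hx s t g k hs ht => ?_⟩
    obtain ⟨r, hr⟩ := exists_isCoordinateTuple_right ν hx (g * k)
    obtain ⟨r', hr'⟩ := (h s t).2 r ((coordMul_iff hν.injective hx hs ht hr).2 rfl)
    obtain ⟨u, v, w, hm, hu, hv, hw⟩ := (h s t).1 r' hr'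
    have hw' : IsCoordinateTuple ν x r' _ := isCoordinateTuple_iff.2 ⟨w, rfl, hw⟩
    have := (coordMul_iff hν.injective hx hs ht hw').1 ⟨u, v, w, hm, hu, hv, hw⟩
    exact ⟨r', hr', this ▸ hw'⟩
  · obtain ⟨u₀, hone⟩ := exists_isCoordinateTuple_one (G := G) ν
    obtain ⟨I, hI, h⟩ := exists_partrec_coordMul_eq hν (repCoord ν u₀)
    refine ⟨I, hI, fun x hx s g hs => ?_⟩
    obtain ⟨r, hr⟩ := exists_isCoordinateTuple_right ν hx g⁻¹
    obtain ⟨r', hr'⟩ := (h s).2 r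
      ((coordMul_iff hν.injective hx hs hr (hone x)).2 (mul_inv_cancel g))
    obtain ⟨u, v, w, hm, hu, hv, hw⟩ := (h s).1 r' hr'
    have hv' : IsCoordinateTuple ν x r' _ := isCoordinateTuple_iff.2 ⟨v, rfl, hv⟩
    have := (coordMul_iff hν.injective hx hs hv' (hone x)).1 ⟨u, v, w, hm, hu, hv, hw⟩
    exact ⟨r', hr', eq_inv_of_mul_eq_one_right this ▸ hv'⟩
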